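/- Let $\mathcal C$ be a category with finite limits (for instance a topos), let $k$ be a commutative ring, and let $R$ be a commutative $k$-algebra object of $\mathcal C$; write $R(T)=\mathrm{Hom}(T,R)$ for the $k$-algebra of elements of $R$ at stage $T$. A Weil algebra is a commutative $k$-algebra $W$ that is free of finite rank as a $k$-module and has an augmentation $W\to k$ with nilpotent kernel; $\mathrm{Spec}_R W$ denotes the object representing $T\mapsto\mathrm{Hom}_{k\text{-alg}}(W,R(T))$, and such objects are called small. Assume the general Kock–Lawvere axiom: for every Weil algebra $W$ and every object $T$, the canonical map $R(T)\otimes_k W\to R(T\times \mathrm{Spec}_R W)$ is bijective. An object $X$ perceives a cocone $(F_j\to P)_j$ as a colimit if for every object $T$ the functor $\mathrm{Hom}(T\times -,X)$ turns it into a limit cone of sets (that is, $X^{(-)}$ turns it into a limit, when exponentials exist). An object $M$ is microlinear if it perceives as a colimit every finite cocone of small objects (with small vertex) that $R$ perceives as a colimit. Let $M$ be microlinear. Below, the internal language of $\mathcal C$ is used: maps and elements are taken at an arbitrary stage $A$, so that a map $Y\to Z$ at stage $A$ is a morphism $A\times Y\to Z$, and $D\to M^M$ stands for $A\times M\times D\to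 M$. Put $D=\{d\in R: d^2=0\}$, $D(2)=\{(d_1,d_2)\in D^2: d_1d_2=0\}$ and $E=\{(d_1,d_2,d_3)\in D^3: d_1d_3=d_2d_3=0\}$. A vector field on $M$ is a map $X:D\to M^M$, $d\mapsto X_d$, with $X_0=\mathrm{id}_M$. The zero vector field is $d\mapsto \mathrm{id}_M$. The sum of two vector fields $X,Y$ is $(X+Y)_d=\ell(d,d)$, where $\ell:D(2)\to M^M$ is the unique map with $\ell(d,0)=X_d$ and $\ell(0,d)=Y_d$. The Lie bracket $[X,Y]$ is the strong difference of the maps $(d_1,d_2)\mapsto Y_{d_2}\circ X_{d_1}$ and $(d_1,d_2)\mapsto X_{d_1}\circ Y_{d_2}$ on $D^2$, that is, $[X,Y]_d=n(0,0,d)$, where $n:E\to M^M$ is the unique map with $n(d_1,d_2,d_1d_2)=Y_{d_2}\circ X_{d_1}$ and $n(d_1,d_2,0)=X_{d_1}\circ Y_{d_2}$ for all $(d_1,d_2)\in D^2$. Then for all vector fields $X_1,X_2,X_3,X_4$ on $M$ the sum of $[X_a,[X_b,[X_c,X_d]]]$ over the twelve even permutations $(a,b,c,d)$ of $(1,2,3,4)$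 vanishes: $$\begin{aligned} &[X_1,[X_2,[X_3,X_4]]]+[X_1,[X_3,[X_4,X_2]]]+[X_1,[X_4,[X_2,X_3]]]\\ {}+{}&[X_2,[X_1,[X_4,X_3]]]+[X_2,[X_3,[X_1,X_4]]]+[X_2,[X_4,[X_3,X_1]]]\\ {}+{}&[X_3,[X_1,[X_2,X_4]]]+[X_3,[X_2,[X_4,X_1]]]+[X_3,[X_4,[X_1,X_2]]]\\ {}+{}&[X_4,[X_1,[X_3,X_2]]]+[X_4,[X_2,[X_1,X_3]]]+[X_4,[X_3,[X_2,X_1]]]=0 . \end{aligned}$$ -/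

import Mathlib

/-!
# Synthetic differential geometry, interpreted in a category with finite limits

Synthetic differential geometry is the internal mathematics of a category `C` with finite limits
(usually a topos) that carries a commutative ring object `R`, the line. A statement of its internal
language is read externally through generalized elements: an element of `X` at stage `T` is a
morphism `T ⟶ X`, a map `X → Y` at stage `T` is a morphism `T ⊗ X ⟶ Y` (where `⊗` is the cartesian
product), and a universally quantified statement is asserted at every stage. By currying, a
morphism `T ⊗ X ⟶ Y` is the same thing as an element `T ⟶ Y ^ X` of the exponential whenever that
exists, so that exponentials are not needed to state anything below.
-/

open CategoryTheory MonoidalCategory CartesianMonoidalCategory Limits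
open scoped CommRingObj TensorProduct

universe w v u

namespace SDG

noncomputable section

section Base

variable {C : Type u} [Category.{v} C] [CartesianMonoidalCategory C] [BraidedCategory C]

/-- Restriction of functions along `f : B ⟶ A`, a ring homomorphism. -/
def restr {R : C} [CommRingObj R] {A B : C} (f : B ⟶ A) : (A ⟶ R) →+* (B ⟶ R) where
  toFun r := f ≫ r
  map_zero' := AddMonObj.comp_zero f
  map_one' := MonObj.comp_one f
  map_add' := AddMonObj.comp_add f
  map_mul' := MonObj.comp_mul f

/-- A `k`-algebra structure on the commutative ring object `R`, for an (external) commutative ring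
`k`: a ring homomorphism from `k` to the global elements of `R`. Every `R` has one for `k = ℤ` and
one for `k = (𝟙_ C ⟶ R)`. -/
class AlgebraObj (k : Type w) [CommRing k] (R : C) [CommRingObj R] where
  /-- The structure map into the ring of global elements. -/
  structureMap : k →+* (𝟙_ C ⟶ R)

/-- The elements of `R` at stage `A` form a `k`-algebra. -/
instance homAlgebra (k : Type w) [CommRing k] (R : C) [CommRingObj R] [AlgebraObj k R] (A : C) :
    Algebra k (A ⟶ R) :=
  ((restr (toUnit A)).comp (AlgebraObj.structureMap (k := k) (R := R))).toAlgebra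

/-- Restriction of functions along `f : B ⟶ A`, a homomorphism of `k`-algebras. -/
def pull (k : Type w) [CommRing k] {R : C} [CommRingObj R] [AlgebraObj k R] {A B : C}
    (f : B ⟶ A) : (A ⟶ R) →ₐ[k] (B ⟶ R) where
  __ := restr f
  commutes' c := by
    change f ≫ toUnit A ≫ _ = toUnit B ≫ _
    rw [← Category.assoc, comp_toUnit]

end Base

/-- `W` is a Weil algebra over `k`: it is free of finite rank as a `k`-module, and it has an
augmentation `W → k` whose kernel is a nilpotent ideal. -/
structure IsWeilAlgebra (k : Type w) [CommRing k] (W : Type w) [CommRing W] [Algebra k W] :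
    Prop where
  free : Module.Free k W
  finite : Module.Finite k W
  exists_augmentation : ∃ ε : W →ₐ[k] k, IsNilpotent (RingHom.ker ε)

section Objects

variable {C : Type u} [Category.{v} C] [CartesianMonoidalCategory C] [BraidedCategory C]
variable (k : Type w) [CommRing k] (R : C) [CommRingObj R] [AlgebraObj k R]

/-- `S`, with the universal point `g`, is the object `Spec_R W` of `k`-algebra homomorphisms from
`W` to `R`: the elements of `S` at stage `A` are, by way of `g`, the `k`-algebra homomorphisms from
`W` to the elements of `R` at stage `A`. For `W = k[x₁, …, xₙ] / (f₁, …, fₘ)` it is the object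
`{x ∈ Rⁿ | f₁ x = … = fₘ x = 0}`. -/
def IsSpec (W : Type w) [CommRing W] [Algebra k W] (S : C) (g : W →ₐ[k] (S ⟶ R)) : Prop :=
  ∀ (A : C) (φ : W →ₐ[k] (A ⟶ R)), ∃! f : A ⟶ S, (pull k f).comp g = φ

/-- The small (infinitesimal) objects: the spectra `Spec_R W` of Weil algebras. -/
def IsSmall (S : C) : Prop :=
  ∃ (W : Type w) (_ : CommRing W) (_ : Algebra k W),
    IsWeilAlgebra k W ∧ ∃ g : W →ₐ[k] (S ⟶ R), IsSpec k R W S g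

/-- The general Kock-Lawvere axiom: for every Weil algebra `W`, the canonical map from `R ⊗ W` to
`R ^ (Spec_R W)` is an isomorphism, that is, bijective on elements at every stage `T`. -/
class KockLawvere : Prop where
  bijective : ∀ (W : Type w) [CommRing W] [Algebra k W], IsWeilAlgebra k W →
    ∀ (S : C) (g : W →ₐ[k] (S ⟶ R)), IsSpec k R W S g → ∀ T : C,
      Function.Bijective
        (Algebra.TensorProduct.productMap (pull k (R := R) (fst T S)) ((pull k (snd T S)).comp g))

end Objects

section Micro
variable {C : Type u} [Category.{v} C] [CartesianMonoidalCategory C]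

/-- `X` perceives the cocone `c` as a colimit: the exponential `X ^ (-)` turns `c` into a limit
cone. It is spelled out on elements at each stage `T`. -/
def Perceives (X : C) {J : Type} [SmallCategory J] {F : J ⥤ C} (c : Cocone F) : Prop :=
  ∀ (T : C) (g : ∀ j, T ⊗ F.obj j ⟶ X),
    (∀ (i j : J) (φ : i ⟶ j), T ◁ F.map φ ≫ g j = g i) →
      ∃! h : T ⊗ c.pt ⟶ X, ∀ j, T ◁ c.ι.app j ≫ h = g j

/-- `M` is microlinear: it perceives as a colimit every quasi-colimit of small objects, that is,
every finite cocone of small objects that the line `R` perceives as a colimit. -/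
class Microlinear [BraidedCategory C] (k : Type w) [CommRing k] (R : C) [CommRingObj R]
    [AlgebraObj k R] (M : C) : Prop where
  perceives : ∀ (J : Type) [SmallCategory J] [FinCategory J] (F : J ⥤ C) (c : Cocone F),
    (∀ j, IsSmall k R (F.obj j)) → IsSmall k R c.pt → Perceives R c → Perceives M c

end Micro

section Simplicial
variable {C : Type u} [Category.{v} C] [CartesianMonoidalCategory C] [BraidedCategory C]
  [HasFiniteLimits C]

/-- The pairs `(i, j)` for which `dᵢ dⱼ = 0` is required in `Dⁿ{p}`: the diagonal and `p`. -/
abbrev killed {n : ℕ} (p : Finset (Fin n × Fin n)) (q : Fin n × Fin n) : Prop :=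
  q.1 = q.2 ∨ q ∈ p

/-- `(d₁, …, dₙ) ↦ (dᵢ dⱼ)` for the pairs `(i, j)` above. -/
def relMap (R : C) [CommRingObj R] (n : ℕ) (p : Finset (Fin n × Fin n)) :
    (∏ᶜ fun _ : Fin n => R) ⟶ (∏ᶜ fun _ : {q // killed p q} => R) :=
  Pi.lift fun q => Pi.π (fun _ : Fin n => R) q.1.1 * Pi.π (fun _ : Fin n => R) q.1.2

/-- The simplicial small object
`Dⁿ{p} = {(d₁, …, dₙ) ∈ Rⁿ | dᵢ² = 0 for all i, dᵢ dⱼ = 0 for all (i, j) ∈ p}`,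
with indices counted from `0`. In particular `D = Dpow R 1 ∅`, `D² = Dpow R 2 ∅` and
`D(2) = Dpow R 2 {(0, 1)}`. -/
def Dpow (R : C) [CommRingObj R] (n : ℕ) (p : Finset (Fin n × Fin n)) : C :=
  equalizer (relMap R n p) (Pi.lift fun _ => 0)

namespace Dpow
variable {R : C} [CommRingObj R] {n : ℕ} {p : Finset (Fin n × Fin n)}

/-- The `i`-th coordinate `Dⁿ{p} → R`. -/
def coord (i : Fin n) : Dpow R n p ⟶ R := equalizer.ι _ _ ≫ Pi.π (fun _ : Fin n => R) i

theorem coord_mul (i j : Fin n) (h : killed p (i, j)) :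
    coord (R := R) (p := p) i * coord j = 0 := by
  have := equalizer.condition (relMap R n p) (Pi.lift fun _ => 0) =≫ Pi.π _ ⟨(i, j), h⟩
  simp only [relMap, Category.assoc, Pi.lift_π, MonObj.comp_mul, AddMonObj.comp_zero] at this
  exact this

theorem coord_self (i : Fin n) : coord (R := R) (p := p) i * coord i = 0 :=
  coord_mul i i (Or.inl rfl)

/-- The element of `Dⁿ{p}` with given coordinates, at stage `A`. -/
def mk {A : C} (d : Fin n → (A ⟶ R)) (hd : ∀ i j, killed p (i, j) → d i * d j = 0) :
    A ⟶ Dpow R n p :=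
  equalizer.lift (Pi.lift d) (by
    apply Pi.hom_ext
    intro q
    simp [relMap, MonObj.comp_mul, AddMonObj.comp_zero, hd _ _ q.2])

@[simp] theorem mk_coord {A : C} (d : Fin n → (A ⟶ R)) (hd) (i : Fin n) :
    mk (p := p) d hd ≫ coord i = d i := by
  exact (equalizer.lift_ι_assoc (Pi.lift d) _ _).trans (Pi.lift_π d i)

theorem hom_ext {A : C} {f g : A ⟶ Dpow R n p} (h : ∀ i, f ≫ coord i = g ≫ coord i) : f = g := by
  apply equalizer.hom_ext
  apply Pi.hom_ext
  intro i
  exact (Category.assoc _ _ _).trans ((h i).trans (Category.assoc _ _ _).symm)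

/-- The origin, at every stage `A`. -/
def zero {A : C} : A ⟶ Dpow R n p := mk (fun _ => 0) (by simp)

@[simp] theorem comp_zero {A B : C} (f : B ⟶ A) : f ≫ (zero : A ⟶ Dpow R n p) = zero :=
  hom_ext fun i => by simp [zero, AddMonObj.comp_zero]

end Dpow
end Simplicial

section Monomial
variable (k : Type w) [CommRing k] {n : ℕ} (p : Finset (Fin n × Fin n))

/-- The ideal of relations of `Dⁿ{p}`. -/
def relIdeal : Ideal (MvPolynomial (Fin n) k) :=
  Ideal.span ((fun s => MvPolynomial.monomial s (1 : k)) ''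
    {s | ∃ i j, killed p (i, j) ∧ s = Finsupp.single i 1 + Finsupp.single j 1})

/-- The Weil algebra of `Dⁿ{p}`. -/
abbrev WeilOf : Type w := MvPolynomial (Fin n) k ⧸ relIdeal k p

/-- The sets `S` whose monomial `∏ i ∈ S, Xᵢ` is not killed. -/
abbrev Indep (S : Finset (Fin n)) : Prop := ∀ i ∈ S, ∀ j ∈ S, i ≠ j → (i, j) ∉ p

/-- The exponent of the monomial `∏ i ∈ S, Xᵢ`. -/
def ind (S : Finset (Fin n)) : Fin n →₀ ℕ := Finsupp.indicator S (fun _ _ => 1)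

theorem ind_apply (S : Finset (Fin n)) (i : Fin n) : ind S i = if i ∈ S then 1 else 0 := by
  simp [ind, Finsupp.indicator_apply]

theorem ind_injective : Function.Injective (ind (n := n)) := by
  intro S S' h
  ext i
  have := DFunLike.congr_fun h i
  simp only [ind_apply] at this
  by_cases h1 : i ∈ S <;> by_cases h2 : i ∈ S' <;> simp_all

theorem not_le_ind {S : Finset (Fin n)} (hS : Indep p S) :
    ¬ ∃ s ∈ {s : Fin n →₀ ℕ | ∃ i j, killed p (i, j) ∧ s = Finsupp.single i 1 + Finsupp.single j 1},
      s ≤ ind S := by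
  rintro ⟨_, ⟨i, j, h, rfl⟩, hle⟩
  have hi := hle i
  have hj := hle j
  simp only [ind_apply, Finsupp.add_apply, Finsupp.single_apply] at hi hj
  by_cases hij : i = j
  · subst hij
    split_ifs at hi <;> simp_all
  · have hji : j ≠ i := fun h => hij h.symm
    have h1 : i ∈ S := by by_contra hc; simp [hc] at hi
    have h2 : j ∈ S := by by_contra hc; simp [hc] at hj
    exact hS i h1 j h2 hij (h.resolve_left hij)

theorem exists_ind (s : Fin n →₀ ℕ)
    (hs : ¬ ∃ t ∈ {s : Fin n →₀ ℕ | ∃ i j, killed p (i, j) ∧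
      s = Finsupp.single i 1 + Finsupp.single j 1}, t ≤ s) :
    ∃ S, Indep p S ∧ s = ind S := by
  refine ⟨s.support, ?_, ?_⟩
  · intro i hi j hj hij hp
    refine hs ⟨_, ⟨i, j, Or.inr hp, rfl⟩, fun a => ?_⟩
    simp only [Finsupp.mem_support_iff] at hi hj
    simp only [Finsupp.add_apply, Finsupp.single_apply]
    split_ifs <;> grind
  · ext i
    rw [ind_apply]
    have h2 : s i < 2 := by
      by_contra hc
      refine hs ⟨_, ⟨i, i, Or.inl rfl, rfl⟩, fun a => ?_⟩
      simp only [Finsupp.add_apply, Finsupp.single_apply]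
      split_ifs <;> grind
    by_cases h : s i = 0
    · simp [h]
    · simp [h]; omega

/-- The class of the monomial `∏ i ∈ S, Xᵢ`. -/
def mono (S : Finset (Fin n)) : WeilOf k p :=
  Ideal.Quotient.mk _ (MvPolynomial.monomial (ind S) 1)

theorem linearIndependent_mono :
    LinearIndependent k (fun S : {S // Indep p S} => mono k p S.1) := by
  rw [Fintype.linearIndependent_iff]
  intro c hc S
  have h1 : (Ideal.Quotient.mk (relIdeal k p))
      (∑ S : {S // Indep p S}, MvPolynomial.monomial (ind S.1) (c S)) = 0 := by
    rw [map_sum, ← hc]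
    refine Finset.sum_congr rfl fun S _ => ?_
    have : MvPolynomial.monomial (ind S.1) (c S) = c S • MvPolynomial.monomial (ind S.1) (1 : k) := by
      simp [MvPolynomial.smul_monomial]
    rw [this]; rfl
  rw [Ideal.Quotient.eq_zero_iff_mem, relIdeal, MvPolynomial.mem_ideal_span_monomial_image] at h1
  by_contra hne
  refine not_le_ind p S.2 (h1 (ind S.1) ?_)
  rw [MvPolynomial.mem_support_iff, MvPolynomial.coeff_sum, Finset.sum_eq_single S]
  · simpa using hne
  · intro S' _ hS'
    rw [MvPolynomial.coeff_monomial, if_neg]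
    exact fun h => hS' (Subtype.ext (ind_injective h))
  · simp

theorem span_mono : ⊤ ≤ Submodule.span k (Set.range fun S : {S // Indep p S} => mono k p S.1) := by
  rintro x -
  obtain ⟨P, rfl⟩ := Ideal.Quotient.mk_surjective x
  induction P using MvPolynomial.induction_on' with
  | add p q hp hq => rw [map_add]; exact Submodule.add_mem _ hp hq
  | monomial s a =>
    have : MvPolynomial.monomial s a = a • MvPolynomial.monomial s (1 : k) := by
      simp [MvPolynomial.smul_monomial]
    rw [this]
    refine Submodule.smul_mem _ a (?_ : Ideal.Quotient.mk (relIdeal k p) (MvPolynomial.monomial s 1) ∈ _)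
    by_cases hs : ∃ t ∈ {s : Fin n →₀ ℕ | ∃ i j, killed p (i, j) ∧
      s = Finsupp.single i 1 + Finsupp.single j 1}, t ≤ s
    · have : Ideal.Quotient.mk (relIdeal k p) (MvPolynomial.monomial s 1) = 0 := by
        rw [Ideal.Quotient.eq_zero_iff_mem, relIdeal, MvPolynomial.mem_ideal_span_monomial_image]
        intro t ht
        have := MvPolynomial.support_monomial_subset ht
        rw [Finset.mem_singleton] at this
        rwa [this]
      rw [this]; exact Submodule.zero_mem _
    · obtain ⟨S, hS, rfl⟩ := exists_ind p s hs
      exact Submodule.subset_span ⟨⟨S, hS⟩, rfl⟩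

/-- The surviving monomials form a basis. -/
def monoBasis : Module.Basis {S // Indep p S} k (WeilOf k p) :=
  Module.Basis.mk (linearIndependent_mono k p) (span_mono k p)

theorem X_mul_X (i j : Fin n) (h : killed p (i, j)) :
    (Ideal.Quotient.mk (relIdeal k p) (MvPolynomial.X i)) *
      (Ideal.Quotient.mk (relIdeal k p) (MvPolynomial.X j)) = 0 := by
  rw [← map_mul, Ideal.Quotient.eq_zero_iff_mem]
  refine Ideal.subset_span ⟨_, ⟨i, j, h, rfl⟩, ?_⟩
  simp [MvPolynomial.X, MvPolynomial.monomial_mul]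

variable {k p} in
/-- The homomorphism given by a tuple that satisfies the relations. -/
def weilLift {B : Type*} [CommRing B] [Algebra k B] (d : Fin n → B)
    (hd : ∀ i j, killed p (i, j) → d i * d j = 0) : WeilOf k p →ₐ[k] B :=
  Ideal.Quotient.liftₐ _ (MvPolynomial.aeval d) (by
    intro a ha
    have : relIdeal k p ≤ RingHom.ker (MvPolynomial.aeval d : _ →ₐ[k] B) := by
      refine Ideal.span_le.2 ?_
      rintro _ ⟨_, ⟨i, j, h, rfl⟩, rfl⟩
      have : MvPolynomial.monomial (Finsupp.single i 1 + Finsupp.single j 1) (1 : k)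
        = MvPolynomial.X i * MvPolynomial.X j := by
          simp [MvPolynomial.X, MvPolynomial.monomial_mul]
      simp [this, RingHom.mem_ker, hd i j h]
    exact this ha)

theorem weilLift_X {B : Type*} [CommRing B] [Algebra k B] (d : Fin n → B) (hd) (i : Fin n) :
    weilLift (k := k) (p := p) d hd (Ideal.Quotient.mk _ (MvPolynomial.X i)) = d i :=
  (Ideal.Quotient.lift_mk _ _ _).trans (MvPolynomial.aeval_X d i)

theorem weilLift_mono {B : Type*} [CommRing B] [Algebra k B] (d : Fin n → B) (hd) (S) :
    weilLift (k := k) (p := p) d hd (mono k p S) = ∏ i ∈ S, d i := by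
  refine (Ideal.Quotient.lift_mk _ _ _).trans ?_
  change MvPolynomial.aeval d (MvPolynomial.monomial (ind S) (1 : k)) = _
  simp [MvPolynomial.aeval_monomial, Finsupp.prod_fintype, ind_apply, Finset.prod_ite_mem,
    pow_ite]

theorem isWeilAlgebra_weilOf : IsWeilAlgebra k (WeilOf k p) where
  free := Module.Free.of_basis (monoBasis k p)
  finite := Module.Finite.of_basis (monoBasis k p)
  exists_augmentation := by
    refine ⟨weilLift (fun _ => 0) (by simp), ?_⟩
    set ε : WeilOf k p →ₐ[k] k := weilLift (fun _ => 0) (by simp)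
    have hker : RingHom.ker ε = Ideal.span (Set.range fun i : Fin n =>
        Ideal.Quotient.mk (relIdeal k p) (MvPolynomial.X i)) := by
      apply le_antisymm
      · intro x hx
        obtain ⟨P, rfl⟩ := Ideal.Quotient.mk_surjective x
        have h0 : MvPolynomial.constantCoeff P = 0 := by
          have h1 : MvPolynomial.aeval (fun _ : Fin n => (0 : k)) P = 0 :=
            (Ideal.Quotient.lift_mk _ _ _).symm.trans hx
          simpa [MvPolynomial.aeval_zero'] using h1
        have hP : P ∈ Ideal.span (MvPolynomial.X '' (Set.univ : Set (Fin n)) :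
            Set (MvPolynomial (Fin n) k)) := by
          rw [MvPolynomial.mem_ideal_span_X_image]
          intro m hm
          by_contra hc
          push Not at hc
          have : m = 0 := by ext i; simpa using hc i
          subst this
          exact (MvPolynomial.mem_support_iff.1 hm) h0
        have := Ideal.mem_map_of_mem (Ideal.Quotient.mk (relIdeal k p)) hP
        rw [Ideal.map_span, Set.image_univ, ← Set.range_comp] at this
        exact this
      · refine Ideal.span_le.2 ?_
        rintro _ ⟨i, rfl⟩
        simp only [SetLike.mem_coe, RingHom.mem_ker]
        exact weilLift_X k p _ _ i
    rw [hker, Ideal.FG.isNilpotent_iff_le_nilradical (Submodule.fg_span (Set.finite_range _))]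
    refine Ideal.span_le.2 ?_
    rintro _ ⟨i, rfl⟩
    exact ⟨2, by rw [pow_two]; exact X_mul_X k p i i (Or.inl rfl)⟩

end Monomial

section Expansion
variable {C : Type u} [Category.{v} C] [CartesianMonoidalCategory C] [BraidedCategory C]
  [HasFiniteLimits C]
variable (k : Type w) [CommRing k] {R : C} [CommRingObj R] [AlgebraObj k R]
  {n : ℕ} (p : Finset (Fin n × Fin n))

theorem isSpec_Dpow : IsSpec k R (WeilOf k p) (Dpow R n p)
    (weilLift (fun i => Dpow.coord i) (fun i j h => Dpow.coord_mul i j h)) := by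
  intro A φ
  refine ⟨Dpow.mk (fun i => φ (Ideal.Quotient.mk _ (MvPolynomial.X i))) ?_, ?_, ?_⟩
  · intro i j h
    rw [← map_mul, X_mul_X k p i j h, map_zero]
  · apply Ideal.Quotient.algHom_ext
    apply MvPolynomial.algHom_ext
    intro i
    change _ ≫ weilLift (fun i => Dpow.coord i) (fun i j h => Dpow.coord_mul i j h)
      (Ideal.Quotient.mk _ (MvPolynomial.X i)) = _
    rw [weilLift_X, Dpow.mk_coord]
    rfl
  · intro f hf
    apply Dpow.hom_ext
    intro i
    rw [Dpow.mk_coord, ← hf]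
    change _ = f ≫ weilLift (fun i => Dpow.coord i) (fun i j h => Dpow.coord_mul i j h)
      (Ideal.Quotient.mk _ (MvPolynomial.X i))
    rw [weilLift_X]

theorem isSmall_Dpow : IsSmall k R (Dpow R n p) :=
  ⟨WeilOf k p, inferInstance, inferInstance, isWeilAlgebra_weilOf k p, _, isSpec_Dpow k p⟩

variable (T : C)

/-- The polynomial function on `Dⁿ{p}` with coefficients `c`. -/
def polyFun (c : {S // Indep p S} → (T ⟶ R)) : T ⊗ Dpow R n p ⟶ R :=
  ∑ S, (fst T (Dpow R n p) ≫ c S) * ∏ i ∈ S.1, snd T (Dpow R n p) ≫ Dpow.coord i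

theorem polyFun_bijective [KockLawvere k R] :
    Function.Bijective (polyFun (R := R) p T) := by
  have h := KockLawvere.bijective (WeilOf k p) (isWeilAlgebra_weilOf k p) (Dpow R n p) _
    (isSpec_Dpow (R := R) k p) T
  let b := Algebra.TensorProduct.basis (T ⟶ R) (monoBasis k p)
  convert h.comp b.equivFun.symm.bijective using 1
  funext c
  simp only [Function.comp_apply, Module.Basis.equivFun_symm_apply, map_sum, polyFun]
  refine Finset.sum_congr rfl fun S _ => ?_
  rw [Algebra.TensorProduct.basis_apply, TensorProduct.smul_tmul', smul_eq_mul, mul_one,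
    Algebra.TensorProduct.productMap_apply_tmul]
  congr 1
  rw [monoBasis, Module.Basis.mk_apply]
  change _ = pull k _ (weilLift (fun i => Dpow.coord i) (fun i j h => Dpow.coord_mul i j h)
    (mono k p S.1))
  rw [weilLift_mono, map_prod]
  rfl

end Expansion

section Glue
variable {C : Type u} [Category.{v} C] [CartesianMonoidalCategory C] [BraidedCategory C]
variable (k : Type w) [CommRing k] (R : C) [CommRingObj R] [AlgebraObj k R]

/-- Microlinearity for a square of small objects. -/
theorem exists_unique_glue {M : C} [Microlinear k R M] {X Y Z P : C} (f : X ⟶ Y) (g : X ⟶ Z)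
    (i : Y ⟶ P) (j : Z ⟶ P) (comm : f ≫ i = g ≫ j) (hX : IsSmall k R X) (hY : IsSmall k R Y)
    (hZ : IsSmall k R Z) (hP : IsSmall k R P)
    (hR : ∀ (T : C) (a : T ⊗ Y ⟶ R) (b : T ⊗ Z ⟶ R), T ◁ f ≫ a = T ◁ g ≫ b →
      ∃! h : T ⊗ P ⟶ R, T ◁ i ≫ h = a ∧ T ◁ j ≫ h = b)
    (T : C) (a : T ⊗ Y ⟶ M) (b : T ⊗ Z ⟶ M) (hab : T ◁ f ≫ a = T ◁ g ≫ b) :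
    ∃! h : T ⊗ P ⟶ M, T ◁ i ≫ h = a ∧ T ◁ j ≫ h = b := by
  have key := Microlinear.perceives (k := k) (R := R) (M := M) WalkingSpan (span f g)
    (PushoutCocone.mk i j comm) (by rintro (_ | _ | _) <;> assumption) hP (by
      intro T γ hγ
      obtain ⟨h, ⟨h1, h2⟩, h3⟩ := hR T (γ WalkingSpan.left) (γ WalkingSpan.right)
        ((hγ _ _ WalkingSpan.Hom.fst).trans (hγ _ _ WalkingSpan.Hom.snd).symm)
      refine ⟨h, ?_, fun h' hh' => h3 h' ⟨hh' WalkingSpan.left, hh' WalkingSpan.right⟩⟩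
      rintro (_ | _ | _)
      · refine Eq.trans ?_ (hγ _ _ WalkingSpan.Hom.fst)
        rw [← h1]
        change T ◁ (f ≫ i) ≫ h = T ◁ f ≫ T ◁ i ≫ h
        rw [MonoidalCategory.whiskerLeft_comp, Category.assoc]
      · exact h1
      · exact h2)
  obtain ⟨h, h1, h2⟩ := key T
    (fun | .zero => T ◁ f ≫ a | .left => a | .right => b) (by
      rintro _ _ (_ | (_ | _))
      · exact (congrArg (· ≫ _) ((congrArg (T ◁ ·) ((span f g).map_id _)).trans
          (MonoidalCategory.whiskerLeft_id _ _))).trans (Category.id_comp _)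
      · rfl
      · exact hab.symm)
  refine ⟨h, ⟨h1 WalkingSpan.left, h1 WalkingSpan.right⟩, fun h' hh' => h2 h' ?_⟩
  rintro (_ | _ | _)
  · change T ◁ (f ≫ i) ≫ h' = T ◁ f ≫ a
    rw [MonoidalCategory.whiskerLeft_comp, Category.assoc, hh'.1]
  · exact hh'.1
  · exact hh'.2

end Glue

section Concrete
variable {C : Type u} [Category.{v} C] [CartesianMonoidalCategory C] [BraidedCategory C]
  [HasFiniteLimits C]

section Exp
variable {R : C} [CommRingObj R]
  {n : ℕ} (p : Finset (Fin n × Fin n)) {T : C}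

theorem sum_eq_polyFun (L : Finset (Finset (Fin n))) (hL : Finset.univ.filter (Indep p) = L)
    (c : Finset (Fin n) → (T ⟶ R)) :
    ∑ S ∈ L, (fst T (Dpow R n p) ≫ c S) * ∏ i ∈ S, snd T (Dpow R n p) ≫ Dpow.coord i =
      polyFun p T (fun S => c S.1) := by
  rw [polyFun]
  exact Finset.sum_subtype L (fun S => by simp [← hL])
    (fun S => (fst T (Dpow R n p) ≫ c S) * ∏ i ∈ S, snd T (Dpow R n p) ≫ Dpow.coord i)

theorem expand_exists (k : Type w) [CommRing k] [AlgebraObj k R] [KockLawvere k R]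
    (L : Finset (Finset (Fin n))) (hL : Finset.univ.filter (Indep p) = L)
    (f : T ⊗ Dpow R n p ⟶ R) : ∃ c : Finset (Fin n) → (T ⟶ R),
      f = ∑ S ∈ L, (fst T (Dpow R n p) ≫ c S) * ∏ i ∈ S, snd T (Dpow R n p) ≫ Dpow.coord i := by
  obtain ⟨c, rfl⟩ := (polyFun_bijective k p T).2 f
  refine ⟨fun S => if h : Indep p S then c ⟨S, h⟩ else 0, ?_⟩
  rw [sum_eq_polyFun p L hL]
  congr 1
  funext S
  rw [dif_pos S.2]

theorem expand_unique (k : Type w) [CommRing k] [AlgebraObj k R] [KockLawvere k R]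
    (L : Finset (Finset (Fin n))) (hL : Finset.univ.filter (Indep p) = L)
    (c c' : Finset (Fin n) → (T ⟶ R))
    (h : ∑ S ∈ L, (fst T (Dpow R n p) ≫ c S) * ∏ i ∈ S, snd T (Dpow R n p) ≫ Dpow.coord i =
      ∑ S ∈ L, (fst T (Dpow R n p) ≫ c' S) * ∏ i ∈ S, snd T (Dpow R n p) ≫ Dpow.coord i) :
    ∀ S ∈ L, c S = c' S := by
  rw [sum_eq_polyFun p L hL, sum_eq_polyFun p L hL] at h
  intro S hS
  rw [← hL, Finset.mem_filter] at hS
  exact congrFun ((polyFun_bijective k p T).1 h) ⟨S, hS.2⟩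

end Exp

section Coeffs
variable {R : C} [CommRingObj R]
  {T : C}

theorem exp_D (k : Type w) [CommRing k] [AlgebraObj k R] [KockLawvere k R]
    (f : T ⊗ Dpow R 1 ∅ ⟶ R) : ∃ a b : T ⟶ R,
    f = fst _ _ ≫ a + (fst _ _ ≫ b) * (snd _ _ ≫ Dpow.coord 0) := by
  obtain ⟨c, hc⟩ := expand_exists (n := 1) ∅ k {∅, {0}} (by decide) f
  exact ⟨c ∅, c {0}, by rw [hc, Finset.sum_pair (by decide)]; simp⟩

theorem exp_D_unique (k : Type w) [CommRing k] [AlgebraObj k R] [KockLawvere k R]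
    {a b a' b' : T ⟶ R}
    (h : fst T (Dpow R 1 ∅) ≫ a + (fst _ _ ≫ b) * (snd _ _ ≫ Dpow.coord 0) =
      fst T (Dpow R 1 ∅) ≫ a' + (fst _ _ ≫ b') * (snd _ _ ≫ Dpow.coord 0)) : a = a' ∧ b = b' := by
  have := expand_unique (n := 1) ∅ k {∅, {0}} (by decide) (fun S => if S = ∅ then a else b)
    (fun S => if S = ∅ then a' else b') (by
      rw [Finset.sum_pair (by decide), Finset.sum_pair (by decide)]; simpa using h)
  exact ⟨by simpa using this ∅ (by decide), by simpa using this {0} (by decide)⟩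

theorem exp_D2 (k : Type w) [CommRing k] [AlgebraObj k R] [KockLawvere k R]
    (f : T ⊗ Dpow R 2 {(0, 1)} ⟶ R) : ∃ a b c : T ⟶ R,
    f = fst _ _ ≫ a + (fst _ _ ≫ b) * (snd _ _ ≫ Dpow.coord 0)
      + (fst _ _ ≫ c) * (snd _ _ ≫ Dpow.coord 1) := by
  obtain ⟨c, hc⟩ := expand_exists (n := 2) {(0, 1)} k {∅, {0}, {1}} (by decide) f
  refine ⟨c ∅, c {0}, c {1}, ?_⟩
  rw [hc, Finset.sum_insert (by decide), Finset.sum_pair (by decide)]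
  simp [add_assoc]

theorem exp_D2_unique (k : Type w) [CommRing k] [AlgebraObj k R] [KockLawvere k R]
    {a b c a' b' c' : T ⟶ R}
    (h : fst T (Dpow R 2 {(0, 1)}) ≫ a + (fst _ _ ≫ b) * (snd _ _ ≫ Dpow.coord 0)
        + (fst _ _ ≫ c) * (snd _ _ ≫ Dpow.coord 1) =
      fst T (Dpow R 2 {(0, 1)}) ≫ a' + (fst _ _ ≫ b') * (snd _ _ ≫ Dpow.coord 0)
        + (fst _ _ ≫ c') * (snd _ _ ≫ Dpow.coord 1)) : a = a' ∧ b = b' ∧ c = c' := by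
  have := expand_unique (n := 2) {(0, 1)} k {∅, {0}, {1}} (by decide)
    (fun S => if S = ∅ then a else if S = {0} then b else c)
    (fun S => if S = ∅ then a' else if S = {0} then b' else c') (by
      rw [Finset.sum_insert (by decide), Finset.sum_pair (by decide),
        Finset.sum_insert (by decide), Finset.sum_pair (by decide)]
      simpa [add_assoc] using h)
  exact ⟨by simpa using this ∅ (by decide), by simpa using this {0} (by decide),
    by simpa using this {1} (by decide)⟩

theorem exp_DD (k : Type w) [CommRing k] [AlgebraObj k R] [KockLawvere k R]
    (f : T ⊗ Dpow R 2 ∅ ⟶ R) : ∃ a b c e : T ⟶ R,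
    f = fst _ _ ≫ a + (fst _ _ ≫ b) * (snd _ _ ≫ Dpow.coord 0)
      + (fst _ _ ≫ c) * (snd _ _ ≫ Dpow.coord 1)
      + (fst _ _ ≫ e) * ((snd _ _ ≫ Dpow.coord 0) * (snd _ _ ≫ Dpow.coord 1)) := by
  obtain ⟨c, hc⟩ := expand_exists (n := 2) ∅ k {∅, {0}, {1}, {0, 1}} (by decide) f
  refine ⟨c ∅, c {0}, c {1}, c {0, 1}, ?_⟩
  rw [hc, Finset.sum_insert (by decide), Finset.sum_insert (by decide),
    Finset.sum_pair (by decide)]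
  simp [add_assoc]

theorem exp_DD_unique (k : Type w) [CommRing k] [AlgebraObj k R] [KockLawvere k R]
    {a b c e a' b' c' e' : T ⟶ R}
    (h : fst T (Dpow R 2 ∅) ≫ a + (fst _ _ ≫ b) * (snd _ _ ≫ Dpow.coord 0)
        + (fst _ _ ≫ c) * (snd _ _ ≫ Dpow.coord 1)
        + (fst _ _ ≫ e) * ((snd _ _ ≫ Dpow.coord 0) * (snd _ _ ≫ Dpow.coord 1)) =
      fst T (Dpow R 2 ∅) ≫ a' + (fst _ _ ≫ b') * (snd _ _ ≫ Dpow.coord 0)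
        + (fst _ _ ≫ c') * (snd _ _ ≫ Dpow.coord 1)
        + (fst _ _ ≫ e') * ((snd _ _ ≫ Dpow.coord 0) * (snd _ _ ≫ Dpow.coord 1))) :
    a = a' ∧ b = b' ∧ c = c' ∧ e = e' := by
  have := expand_unique (n := 2) ∅ k {∅, {0}, {1}, {0, 1}} (by decide)
    (fun S => if S = ∅ then a else if S = {0} then b else if S = {1} then c else e)
    (fun S => if S = ∅ then a' else if S = {0} then b' else if S = {1} then c' else e') (by
      rw [Finset.sum_insert (by decide), Finset.sum_insert (by decide),
        Finset.sum_pair (by decide), Finset.sum_insert (by decide),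
        Finset.sum_insert (by decide), Finset.sum_pair (by decide)]
      have e1 : ({0, 1} : Finset (Fin 2)) ≠ ∅ := by decide
      have e2 : ({0, 1} : Finset (Fin 2)) ≠ {0} := by decide
      have e3 : ({0, 1} : Finset (Fin 2)) ≠ {1} := by decide
      simpa [add_assoc, e1, e2, e3] using h)
  have e1 : ({0, 1} : Finset (Fin 2)) ≠ ∅ := by decide
  have e2 : ({0, 1} : Finset (Fin 2)) ≠ {0} := by decide
  have e3 : ({0, 1} : Finset (Fin 2)) ≠ {1} := by decide
  exact ⟨by simpa using this ∅ (by decide), by simpa using this {0} (by decide),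
    by simpa using this {1} (by decide), by simpa [e1, e2, e3] using this {0, 1} (by decide)⟩

theorem exp_E (k : Type w) [CommRing k] [AlgebraObj k R] [KockLawvere k R]
    (f : T ⊗ Dpow R 3 {(0, 2), (1, 2)} ⟶ R) : ∃ a b c e h : T ⟶ R,
    f = fst _ _ ≫ a + (fst _ _ ≫ b) * (snd _ _ ≫ Dpow.coord 0)
      + (fst _ _ ≫ c) * (snd _ _ ≫ Dpow.coord 1)
      + (fst _ _ ≫ e) * ((snd _ _ ≫ Dpow.coord 0) * (snd _ _ ≫ Dpow.coord 1))
      + (fst _ _ ≫ h) * (snd _ _ ≫ Dpow.coord 2) := by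
  obtain ⟨c, hc⟩ := expand_exists (n := 3) {(0, 2), (1, 2)} k {∅, {0}, {1}, {0, 1}, {2}} (by decide) f
  refine ⟨c ∅, c {0}, c {1}, c {0, 1}, c {2}, ?_⟩
  rw [hc, Finset.sum_insert (by decide), Finset.sum_insert (by decide),
    Finset.sum_insert (by decide), Finset.sum_pair (by decide)]
  simp [add_assoc]

end Coeffs

section Maps
variable {R : C} [CommRingObj R]

/-- `(d₁, d₂) ∈ D(2) ↦ (d₁, d₂) ∈ D²`. -/
def inclD2 : Dpow R 2 {(0, 1)} ⟶ Dpow R 2 ∅ :=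
  Dpow.mk ![Dpow.coord 0, Dpow.coord 1] (by
    intro i j h
    fin_cases i <;> fin_cases j <;> simp [killed] at h ⊢ <;> exact Dpow.coord_mul _ _ (by decide))

/-- `d ∈ D ↦ (d, 0) ∈ D(2)`. -/
def axis₁ : Dpow R 1 ∅ ⟶ Dpow R 2 {(0, 1)} :=
  Dpow.mk ![Dpow.coord 0, 0] (by
    intro i j h
    fin_cases i <;> fin_cases j <;> simp [Dpow.coord_self])

/-- `d ∈ D ↦ (0, d) ∈ D(2)`. -/
def axis₂ : Dpow R 1 ∅ ⟶ Dpow R 2 {(0, 1)} :=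
  Dpow.mk ![0, Dpow.coord 0] (by
    intro i j h
    fin_cases i <;> fin_cases j <;> simp [Dpow.coord_self])

/-- `d ∈ D ↦ (d, d) ∈ D(2)`. -/
def diag : Dpow R 1 ∅ ⟶ Dpow R 2 {(0, 1)} :=
  Dpow.mk ![Dpow.coord 0, Dpow.coord 0] (by
    intro i j h
    fin_cases i <;> fin_cases j <;> simp [Dpow.coord_self])

/-- `(d₁, d₂) ∈ D² ↦ (d₁, d₂, d₁ d₂) ∈ D³{(1,3),(2,3)}`. -/
def j₁ : Dpow R 2 ∅ ⟶ Dpow R 3 {(0, 2), (1, 2)} :=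
  Dpow.mk ![Dpow.coord 0, Dpow.coord 1, Dpow.coord 0 * Dpow.coord 1] (by
    have h0 : Dpow.coord (R := R) (p := ∅) (0 : Fin 2) * Dpow.coord 0 = 0 :=
      Dpow.coord_mul _ _ (by decide)
    have h1 : Dpow.coord (R := R) (p := ∅) (1 : Fin 2) * Dpow.coord 1 = 0 :=
      Dpow.coord_mul _ _ (by decide)
    intro i j h
    fin_cases i <;> fin_cases j <;> simp [killed] at h ⊢ <;> grind)

/-- `(d₁, d₂) ∈ D² ↦ (d₁, d₂, 0) ∈ D³{(1,3),(2,3)}`. -/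
def j₂ : Dpow R 2 ∅ ⟶ Dpow R 3 {(0, 2), (1, 2)} :=
  Dpow.mk ![Dpow.coord 0, Dpow.coord 1, 0] (by
    intro i j h
    fin_cases i <;> fin_cases j <;> simp [killed] at h ⊢ <;> exact Dpow.coord_mul _ _ (by decide))

/-- `d ∈ D ↦ (0, 0, d) ∈ D³{(1,3),(2,3)}`. -/
def axis₃ : Dpow R 1 ∅ ⟶ Dpow R 3 {(0, 2), (1, 2)} :=
  Dpow.mk ![0, 0, Dpow.coord 0] (by
    intro i j h
    fin_cases i <;> fin_cases j <;> simp [Dpow.coord_self])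

end Maps

section Perc
variable {R : C} [CommRingObj R]

theorem perceives_D2 (k : Type w) [CommRing k] [AlgebraObj k R] [KockLawvere k R]
    (T : C) (a b : T ⊗ Dpow R 1 ∅ ⟶ R)
    (hab : T ◁ (Dpow.zero : Dpow R 0 ∅ ⟶ Dpow R 1 ∅) ≫ a = T ◁ Dpow.zero ≫ b) :
    ∃! h : T ⊗ Dpow R 2 {(0, 1)} ⟶ R, T ◁ axis₁ ≫ h = a ∧ T ◁ axis₂ ≫ h = b := by
  obtain ⟨a0, a1, rfl⟩ := exp_D k a
  obtain ⟨b0, b1, rfl⟩ := exp_D k b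
  have h0 : a0 = b0 := by
    have := lift (𝟙 T) Dpow.zero ≫= hab
    simpa [Dpow.zero, AddMonObj.comp_add, MonObj.comp_mul, AddMonObj.comp_zero] using this
  subst h0
  refine ⟨fst _ _ ≫ a0 + (fst _ _ ≫ a1) * (snd _ _ ≫ Dpow.coord 0)
      + (fst _ _ ≫ b1) * (snd _ _ ≫ Dpow.coord 1), ?_, ?_⟩
  · simp [axis₁, axis₂, AddMonObj.comp_add, MonObj.comp_mul, AddMonObj.comp_zero]
  · rintro h ⟨h1, h2⟩
    obtain ⟨e0, e1, e2, rfl⟩ := exp_D2 k h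
    simp [axis₁, axis₂, AddMonObj.comp_add, MonObj.comp_mul, AddMonObj.comp_zero] at h1 h2
    obtain ⟨rfl, rfl⟩ := exp_D_unique k h1
    obtain ⟨-, rfl⟩ := exp_D_unique k h2
    rfl

theorem perceives_E (k : Type w) [CommRing k] [AlgebraObj k R] [KockLawvere k R]
    (T : C) (a b : T ⊗ Dpow R 2 ∅ ⟶ R) (hab : T ◁ inclD2 ≫ a = T ◁ inclD2 ≫ b) :
    ∃! h : T ⊗ Dpow R 3 {(0, 2), (1, 2)} ⟶ R, T ◁ j₁ ≫ h = a ∧ T ◁ j₂ ≫ h = b := by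
  obtain ⟨a0, a1, a2, a3, rfl⟩ := exp_DD k a
  obtain ⟨b0, b1, b2, b3, rfl⟩ := exp_DD k b
  have hz : (snd T (Dpow R 2 {(0, 1)}) ≫ Dpow.coord 0) * (snd T (Dpow R 2 {(0, 1)}) ≫ Dpow.coord 1)
      = 0 := by
    rw [← MonObj.comp_mul, Dpow.coord_mul _ _ (by decide), AddMonObj.comp_zero]
  simp [inclD2, AddMonObj.comp_add, MonObj.comp_mul, hz] at hab
  obtain ⟨rfl, rfl, rfl⟩ := exp_D2_unique k hab
  refine ⟨fst _ _ ≫ a0 + (fst _ _ ≫ a1) * (snd _ _ ≫ Dpow.coord 0)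
      + (fst _ _ ≫ a2) * (snd _ _ ≫ Dpow.coord 1)
      + (fst _ _ ≫ b3) * ((snd _ _ ≫ Dpow.coord 0) * (snd _ _ ≫ Dpow.coord 1))
      + (fst _ _ ≫ (a3 - b3)) * (snd _ _ ≫ Dpow.coord 2), ?_, ?_⟩
  · have hs : fst T (Dpow R 2 ∅) ≫ (a3 - b3) = fst _ _ ≫ a3 - fst _ _ ≫ b3 :=
      map_sub (restr (fst T (Dpow R 2 ∅))) a3 b3
    simp [j₁, j₂, AddMonObj.comp_add, MonObj.comp_mul, AddMonObj.comp_zero, hs]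
    ring
  · rintro h ⟨h1, h2⟩
    obtain ⟨e0, e1, e2, e3, e4, rfl⟩ := exp_E k h
    simp [j₁, j₂, AddMonObj.comp_add, MonObj.comp_mul, AddMonObj.comp_zero] at h1 h2
    obtain ⟨rfl, rfl, rfl, rfl⟩ := exp_DD_unique k h2
    rw [add_assoc, ← add_mul, ← AddMonObj.comp_add] at h1
    obtain ⟨-, -, -, rfl⟩ := exp_DD_unique k h1
    rw [add_sub_cancel_left]

end Perc

end Concrete

section VectorFields
variable {C : Type u} [Category.{v} C] [CartesianMonoidalCategory C] [BraidedCategory C]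
  [HasFiniteLimits C]

section Operations
variable {R : C} [CommRingObj R] {M T : C}

/-- Two tangent vectors with the same base point extend to a unique map on `D(2)`. -/
theorem exists_unique_sum (k : Type w) [CommRing k] [AlgebraObj k R] [KockLawvere k R]
    [Microlinear k R M] (t₁ t₂ : T ⊗ Dpow R 1 ∅ ⟶ M)
    (h : lift (𝟙 T) Dpow.zero ≫ t₁ = lift (𝟙 T) Dpow.zero ≫ t₂) :
    ∃! l : T ⊗ Dpow R 2 {(0, 1)} ⟶ M, T ◁ axis₁ ≫ l = t₁ ∧ T ◁ axis₂ ≫ l = t₂ := by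
  refine exists_unique_glue k R (Dpow.zero : Dpow R 0 ∅ ⟶ Dpow R 1 ∅) Dpow.zero axis₁ axis₂ ?_
    (isSmall_Dpow k _) (isSmall_Dpow k _) (isSmall_Dpow k _) (isSmall_Dpow k _)
    (perceives_D2 k) T t₁ t₂ ?_
  · apply Dpow.hom_ext
    intro i
    fin_cases i <;> simp [axis₁, axis₂, Dpow.zero, AddMonObj.comp_zero]
  · have e : T ◁ (Dpow.zero : Dpow R 0 ∅ ⟶ Dpow R 1 ∅) =
        fst T (Dpow R 0 ∅) ≫ lift (𝟙 T) Dpow.zero := by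
      ext <;> simp
    rw [e, Category.assoc, Category.assoc, h]

/-- The sum of two tangent vectors `t₁, t₂ : D → M` with the same base point: `d ↦ l (d, d)`, where
`l : D(2) → M` is the unique map with `l (d, 0) = t₁ d` and `l (0, d) = t₂ d`. -/
def tangentSum (k : Type w) [CommRing k] [AlgebraObj k R] [KockLawvere k R]
    [Microlinear k R M] (t₁ t₂ : T ⊗ Dpow R 1 ∅ ⟶ M)
    (h : lift (𝟙 T) Dpow.zero ≫ t₁ = lift (𝟙 T) Dpow.zero ≫ t₂) : T ⊗ Dpow R 1 ∅ ⟶ M :=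
  T ◁ diag ≫ (exists_unique_sum k t₁ t₂ h).choose

/-- Two microsquares that agree on `D(2)` extend to a unique map on `D³{(1,3),(2,3)}`. -/
theorem exists_unique_strongDiff (k : Type w) [CommRing k] [AlgebraObj k R] [KockLawvere k R]
    [Microlinear k R M] (γ₁ γ₂ : T ⊗ Dpow R 2 ∅ ⟶ M)
    (h : T ◁ inclD2 ≫ γ₁ = T ◁ inclD2 ≫ γ₂) :
    ∃! n : T ⊗ Dpow R 3 {(0, 2), (1, 2)} ⟶ M, T ◁ j₁ ≫ n = γ₁ ∧ T ◁ j₂ ≫ n = γ₂ := by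
  refine exists_unique_glue k R inclD2 inclD2 j₁ j₂ ?_
    (isSmall_Dpow k _) (isSmall_Dpow k _) (isSmall_Dpow k _) (isSmall_Dpow k _)
    (perceives_E k) T γ₁ γ₂ h
  have hz : Dpow.coord (R := R) (p := {(0, 1)}) (0 : Fin 2) * Dpow.coord 1 = 0 :=
    Dpow.coord_mul _ _ (by decide)
  apply Dpow.hom_ext
  intro i
  fin_cases i <;> simp [inclD2, j₁, j₂, MonObj.comp_mul, AddMonObj.comp_zero, hz]

/-- The strong difference of two microsquares `γ₁, γ₂ : D² → M` that agree on `D(2)`: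
`d ↦ n (0, 0, d)`, where `n : D³{(1,3),(2,3)} → M` is the unique map with
`n (d₁, d₂, d₁ d₂) = γ₁ (d₁, d₂)` and `n (d₁, d₂, 0) = γ₂ (d₁, d₂)`. -/
def strongDiff (k : Type w) [CommRing k] [AlgebraObj k R] [KockLawvere k R]
    [Microlinear k R M] (γ₁ γ₂ : T ⊗ Dpow R 2 ∅ ⟶ M) (h : T ◁ inclD2 ≫ γ₁ = T ◁ inclD2 ≫ γ₂) :
    T ⊗ Dpow R 1 ∅ ⟶ M :=
  T ◁ axis₃ ≫ (exists_unique_strongDiff k γ₁ γ₂ h).choose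

end Operations

/-- A vector field on `M` at stage `A`: a map `d ∈ D ↦ X_d ∈ M ^ M` with `X_0 = id`, in the form
`flow (a, m, d) = X_d (m)`. The vector fields in the ordinary sense are those at stage `𝟙_ C`; the
parameter `a : A` makes `X` an arbitrary generalized element of the object of vector fields.
The ring `k` is carried along only as a label for the operations below. -/
@[ext]
structure VectorField (k : Type w) (R : C) [CommRingObj R] (M A : C) where
  /-- `(a, m, d) ↦ X_d (m)` -/
  flow : (A ⊗ M) ⊗ Dpow R 1 ∅ ⟶ M
  flow_zero : lift (𝟙 (A ⊗ M)) Dpow.zero ≫ flow = snd A M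

/-- The `i`-th coordinate `Dⁿ{p} → D`. -/
def Dpow.pr {R : C} [CommRingObj R] {n : ℕ} {p : Finset (Fin n × Fin n)} (i : Fin n) :
    Dpow R n p ⟶ Dpow R 1 ∅ :=
  Dpow.mk (fun _ => Dpow.coord i) (fun _ _ _ => Dpow.coord_self i)

/-- `(d₁, d₂) ∈ D² ↦ (d₂, d₁) ∈ D²`. -/
def swap {R : C} [CommRingObj R] : Dpow R 2 ∅ ⟶ Dpow R 2 ∅ :=
  Dpow.mk ![Dpow.coord 1, Dpow.coord 0] (by
    intro i j h
    fin_cases i <;> fin_cases j <;> simp [killed, Dpow.coord_self] at h ⊢)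

namespace VectorField
variable {k : Type w} {R : C} [CommRingObj R] {M A : C}

/-- The point `X_d (m)`, for elements `a`, `d`, `m` at stage `T`. -/
def act (X : VectorField k R M A) {T : C} (a : T ⟶ A) (d : T ⟶ Dpow R 1 ∅) (m : T ⟶ M) : T ⟶ M :=
  lift (lift a m) d ≫ X.flow

theorem comp_act (X : VectorField k R M A) {T T' : C} (f : T' ⟶ T) (a : T ⟶ A)
    (d : T ⟶ Dpow R 1 ∅) (m : T ⟶ M) : f ≫ X.act a d m = X.act (f ≫ a) (f ≫ d) (f ≫ m) := by
  simp only [act, ← Category.assoc, comp_lift]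

theorem act_zero (X : VectorField k R M A) {T : C} (a : T ⟶ A) (m : T ⟶ M) :
    X.act a Dpow.zero m = m := by
  have e : lift (lift a m) (Dpow.zero : T ⟶ Dpow R 1 ∅) =
      lift a m ≫ lift (𝟙 (A ⊗ M)) Dpow.zero := by
    ext <;> simp
  rw [act, e, Category.assoc, X.flow_zero, lift_snd]

theorem act_univ (X : VectorField k R M A) :
    X.act (fst (A ⊗ M) _ ≫ fst A M) (snd _ _) (fst (A ⊗ M) _ ≫ snd A M) = X.flow := by
  have e : lift (lift (fst (A ⊗ M) (Dpow R 1 ∅) ≫ fst A M) (fst (A ⊗ M) _ ≫ snd A M))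
      (snd (A ⊗ M) (Dpow R 1 ∅)) = 𝟙 _ := by
    ext <;> simp
  rw [act, e, Category.id_comp]

/-- `Y ∗ X`, the map `(d₁, d₂) ∈ D² ↦ Y_{d₂} ∘ X_{d₁} ∈ M ^ M`. -/
def star (Y X : VectorField k R M A) : (A ⊗ M) ⊗ Dpow R 2 ∅ ⟶ M :=
  Y.act (fst _ _ ≫ fst _ _) (snd _ _ ≫ Dpow.pr 1)
    (X.act (fst _ _ ≫ fst _ _) (snd _ _ ≫ Dpow.pr 0) (fst _ _ ≫ snd _ _))

/-- The zero vector field, `d ↦ id`. -/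
instance : Zero (VectorField k R M A) where
  zero := ⟨fst _ _ ≫ snd _ _, by simp⟩

variable [CommRing k] [AlgebraObj k R] [KockLawvere k R] [Microlinear k R M]

/-- Vector fields are added as tangent vectors, pointwise. -/
instance : Add (VectorField k R M A) where
  add X Y :=
    { flow := tangentSum k X.flow Y.flow (X.flow_zero.trans Y.flow_zero.symm)
      flow_zero := by
        have h := (exists_unique_sum k X.flow Y.flow
          (X.flow_zero.trans Y.flow_zero.symm)).choose_spec.1.1
        have e : (Dpow.zero : A ⊗ M ⟶ Dpow R 1 ∅) ≫ diag = Dpow.zero ≫ axis₁ := by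
          apply Dpow.hom_ext
          intro i
          fin_cases i <;> simp [diag, axis₁, Dpow.zero, AddMonObj.comp_zero]
        rw [tangentSum, lift_whiskerLeft_assoc, e, ← lift_whiskerLeft_assoc, h, X.flow_zero] }

theorem star_compat (Y X : VectorField k R M A) :
    (A ⊗ M) ◁ inclD2 ≫ star Y X = (A ⊗ M) ◁ inclD2 ≫ (A ⊗ M) ◁ swap ≫ star X Y := by
  have p1 : (axis₁ ≫ inclD2) ≫ Dpow.pr 0 = 𝟙 (Dpow R 1 ∅) := Dpow.hom_ext fun i => by
    fin_cases i; simp [axis₁, inclD2, Dpow.pr]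
  have p2 : (axis₁ ≫ inclD2) ≫ Dpow.pr 1 = (Dpow.zero : Dpow R 1 ∅ ⟶ _) := Dpow.hom_ext fun i => by
    fin_cases i; simp [axis₁, inclD2, Dpow.pr, Dpow.zero]
  have p3 : (axis₂ ≫ inclD2) ≫ Dpow.pr 0 = (Dpow.zero : Dpow R 1 ∅ ⟶ _) := Dpow.hom_ext fun i => by
    fin_cases i; simp [axis₂, inclD2, Dpow.pr, Dpow.zero]
  have p4 : (axis₂ ≫ inclD2) ≫ Dpow.pr 1 = 𝟙 (Dpow R 1 ∅) := Dpow.hom_ext fun i => by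
    fin_cases i; simp [axis₂, inclD2, Dpow.pr]
  have s0 : swap ≫ Dpow.pr 0 = (Dpow.pr 1 : Dpow R 2 ∅ ⟶ _) := Dpow.hom_ext fun i => by
    fin_cases i; simp [swap, Dpow.pr]
  have s1 : swap ≫ Dpow.pr 1 = (Dpow.pr 0 : Dpow R 2 ∅ ⟶ _) := Dpow.hom_ext fun i => by
    fin_cases i; simp [swap, Dpow.pr]
  simp only [Category.assoc] at p1 p2 p3 p4
  refine (exists_unique_sum k X.flow Y.flow (X.flow_zero.trans Y.flow_zero.symm)).unique
    ⟨?_, ?_⟩ ⟨?_, ?_⟩ <;>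
  simp [star, comp_act, act_zero, act_univ, p1, p2, p3, p4, s0, s1]

/-- The Lie bracket `[X, Y]`: the strong difference of `Y ∗ X` and of `X ∗ Y` with its two
arguments exchanged, that is, of `(d₁, d₂) ↦ Y_{d₂} ∘ X_{d₁}` and `(d₁, d₂) ↦ X_{d₁} ∘ Y_{d₂}`. -/
instance : Bracket (VectorField k R M A) (VectorField k R M A) where
  bracket X Y :=
    { flow := strongDiff k (star Y X) ((A ⊗ M) ◁ swap ≫ star X Y) (star_compat Y X)
      flow_zero := by
        have h := (exists_unique_strongDiff k (star Y X) ((A ⊗ M) ◁ swap ≫ star X Y)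
          (star_compat Y X)).choose_spec.1.2
        have e : (Dpow.zero : A ⊗ M ⟶ Dpow R 1 ∅) ≫ axis₃ = Dpow.zero ≫ j₂ := by
          apply Dpow.hom_ext
          intro i
          fin_cases i <;> simp [j₂, axis₃, Dpow.zero, AddMonObj.comp_zero]
        have z (i : Fin 2) : (Dpow.zero : A ⊗ M ⟶ Dpow R 2 ∅) ≫ swap ≫ Dpow.pr i = Dpow.zero :=
          Dpow.hom_ext fun j => by
            fin_cases i <;> simp [swap, Dpow.pr, Dpow.zero]
        rw [strongDiff, lift_whiskerLeft_assoc, e, ← lift_whiskerLeft_assoc, h]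
        simp [star, comp_act, act_zero, z] }

end VectorField

end VectorFields

end

end SDG

/-! The twelve even permutations split by first entry a into four triples, and within a triple the
other three indices run through one cyclic orbit. Each triple is therefore [X_a, J], where J is a
Jacobi sum of the other three fields. So the theorem reduces to additivity of the bracket in its
second argument, [X, 0] = 0, and the Jacobi identity.

These are proved by turning gluing statements into algebra in the monoid of maps M → M at a stage.
On D(2) the fields X and Y are glued by a composite, so (X + Y)_d = X_d Y_d, and X_d commutes with
Y_e whenever de = 0 (`add_pt`, `pt_comm`). For the bracket, D³{(1,3),(2,3)} is used in a second way:
microlinear objects perceive it also as the wedge of D² and D (`hom_ext_wedge`). This forces the map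
defining the strong difference to be (d₁, d₂, d₃) ↦ X_{d₁} Y_{d₂} [X,Y]_{d₃}. Its restriction to d₃
= d₁d₂ gives the commutator formula Y_e X_d = X_d Y_e [X,Y]_{de} (`pt_mul_pt`), and this formula
characterizes the bracket (`bracket_eq`).

The Jacobi identity is then a Hall–Witt argument: Z_f Y_e X_d is brought to the order X, Y, Z in two
ways, and the correction factors are compared (`mul_eq_of_commutators`). The comparison holds only
at parameters def; it extends to all of D because a field trivial at such products is zero
(`eq_zero_of_pt_scale_scale`). -/

namespace SDG

noncomputable section

/-! ### The monoid of maps M → M at a stage, and restriction of ring operations. -/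

variable {C : Type u} [Category.{v} C] [CartesianMonoidalCategory C]

/-- The maps `M → M` at stage `S`, a monoid under composition. -/
@[ext]
structure Endo (S M : C) where
  /-- `(s, m) ↦ f_s (m)` -/
  hom : S ⊗ M ⟶ M

namespace Endo
variable {S M : C}

instance : Monoid (Endo S M) where
  mul f g := ⟨lift (fst S M) g.hom ≫ f.hom⟩
  one := ⟨snd S M⟩
  mul_assoc f g h := Endo.ext <| by
    change lift (fst S M) h.hom ≫ lift (fst S M) g.hom ≫ f.hom =
      lift (fst S M) (lift (fst S M) h.hom ≫ g.hom) ≫ f.hom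
    rw [← Category.assoc, comp_lift, lift_fst]
  one_mul f := Endo.ext <| lift_snd (fst S M) f.hom
  mul_one f := Endo.ext <| by
    change lift (fst S M) (snd S M) ≫ f.hom = f.hom
    rw [lift_fst_snd, Category.id_comp]

/-- The point `f (m)`, for an element `m` at stage `S`. -/
def ap (f : Endo S M) (m : S ⟶ M) : S ⟶ M := lift (𝟙 S) m ≫ f.hom

theorem mul_ap (f g : Endo S M) (m : S ⟶ M) : (f * g).ap m = f.ap (g.ap m) := by
  change lift (𝟙 S) m ≫ lift (fst S M) g.hom ≫ f.hom = lift (𝟙 S) (lift (𝟙 S) m ≫ g.hom) ≫ f.hom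
  rw [← Category.assoc, comp_lift, lift_fst]

end Endo

section Ring
variable [BraidedCategory C] {R : C} [CommRingObj R]

theorem comp_sub {S T : C} (f : S ⟶ T) (r s : T ⟶ R) : f ≫ (r - s) = f ≫ r - f ≫ s :=
  map_sub (restr f) r s

theorem comp_neg_one {S T : C} (f : S ⟶ T) : f ≫ (-1 : T ⟶ R) = -1 :=
  (map_neg (restr f) 1).trans (congrArg _ (map_one (restr f)))

end Ring

variable [BraidedCategory C] [HasFiniteLimits C]

/-! ### D³{(1,3),(2,3)} as a wedge of D² and D. -/

section Wedge
variable {R : C} [CommRingObj R]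

/-- The line perceives `D³{(1,3),(2,3)}` as the wedge of `D²` and `D`. -/
theorem perceives_wedge (k : Type w) [CommRing k] [AlgebraObj k R] [KockLawvere k R]
    (T : C) (a : T ⊗ Dpow R 2 ∅ ⟶ R) (b : T ⊗ Dpow R 1 ∅ ⟶ R)
    (hab : T ◁ (Dpow.zero : Dpow R 0 ∅ ⟶ Dpow R 2 ∅) ≫ a = T ◁ Dpow.zero ≫ b) :
    ∃! h : T ⊗ Dpow R 3 {(0, 2), (1, 2)} ⟶ R, T ◁ j₂ ≫ h = a ∧ T ◁ axis₃ ≫ h = b := by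
  obtain ⟨a0, a1, a2, a3, rfl⟩ := exp_DD k a
  obtain ⟨b0, b1, rfl⟩ := exp_D k b
  have h0 : a0 = b0 := by
    -- Evaluation at the origin isolates the constant terms, the only coefficients that the two
    -- functions share.
    have := lift (𝟙 T) Dpow.zero ≫= hab
    simpa [Dpow.zero, AddMonObj.comp_add, MonObj.comp_mul, AddMonObj.comp_zero] using this
  subst h0
  -- Since d₁d₃ = d₂d₃ = 0, the surviving monomials are 1, d₁, d₂, d₁d₂ and d₃: the first four
  -- coefficients come from D², the last from D.
  refine ⟨fst _ _ ≫ a0 + (fst _ _ ≫ a1) * (snd _ _ ≫ Dpow.coord 0)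
      + (fst _ _ ≫ a2) * (snd _ _ ≫ Dpow.coord 1)
      + (fst _ _ ≫ a3) * ((snd _ _ ≫ Dpow.coord 0) * (snd _ _ ≫ Dpow.coord 1))
      + (fst _ _ ≫ b1) * (snd _ _ ≫ Dpow.coord 2), ?_, ?_⟩
  · simp [j₂, axis₃, AddMonObj.comp_add, MonObj.comp_mul, AddMonObj.comp_zero]
  · rintro h ⟨h1, h2⟩
    obtain ⟨e0, e1, e2, e3, e4, rfl⟩ := exp_E k h
    simp [j₂, axis₃, AddMonObj.comp_add, MonObj.comp_mul, AddMonObj.comp_zero] at h1 h2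
    obtain ⟨rfl, rfl, rfl, rfl⟩ := exp_DD_unique k h1
    obtain ⟨-, rfl⟩ := exp_D_unique k h2
    rfl

/-- A map on `D³{(1,3),(2,3)}` is determined by its restrictions to `D²` and to the third axis. -/
theorem hom_ext_wedge (k : Type w) [CommRing k] [AlgebraObj k R] [KockLawvere k R] {M T : C}
    [Microlinear k R M] {f g : T ⊗ Dpow R 3 {(0, 2), (1, 2)} ⟶ M}
    (h₂ : T ◁ j₂ ≫ f = T ◁ j₂ ≫ g) (h₃ : T ◁ axis₃ ≫ f = T ◁ axis₃ ≫ g) : f = g := by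
  have e : (Dpow.zero : Dpow R 0 ∅ ⟶ Dpow R 2 ∅) ≫ j₂ = Dpow.zero ≫ axis₃ := by
    apply Dpow.hom_ext
    intro i
    fin_cases i <;> simp [j₂, axis₃, Dpow.zero, AddMonObj.comp_zero]
  refine (exists_unique_glue k R (Dpow.zero : Dpow R 0 ∅ ⟶ Dpow R 2 ∅) Dpow.zero j₂ axis₃ e
    (isSmall_Dpow k _) (isSmall_Dpow k _) (isSmall_Dpow k _) (isSmall_Dpow k _)
    (perceives_wedge k) T (T ◁ j₂ ≫ g) (T ◁ axis₃ ≫ g) ?_).unique ⟨h₂, h₃⟩ ⟨rfl, rfl⟩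
  rw [← Category.assoc, ← Category.assoc, ← MonoidalCategory.whiskerLeft_comp,
    ← MonoidalCategory.whiskerLeft_comp, e]

end Wedge

/-! ### Elements of D, D² and D(2) at a stage. -/

namespace Dpow
variable {R : C} [CommRingObj R]

theorem comp_coord_mul_self {S : C} (d : S ⟶ Dpow R 1 ∅) : (d ≫ coord 0) * (d ≫ coord 0) = 0 := by
  rw [← MonObj.comp_mul, coord_self, AddMonObj.comp_zero]

/-- The element `r d` of `D`, for `d` in `D` and `r` in `R`. -/
def scale {S : C} (r : S ⟶ R) (d : S ⟶ Dpow R 1 ∅) : S ⟶ Dpow R 1 ∅ :=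
  mk (fun _ => r * (d ≫ coord 0)) (fun _ _ _ => by
    rw [mul_mul_mul_comm, comp_coord_mul_self, mul_zero])

@[simp] theorem scale_coord {S : C} (r : S ⟶ R) (d : S ⟶ Dpow R 1 ∅) (i : Fin 1) :
    scale r d ≫ coord i = r * (d ≫ coord 0) := mk_coord _ _ i

theorem comp_scale {S S' : C} (f : S' ⟶ S) (r : S ⟶ R) (d : S ⟶ Dpow R 1 ∅) :
    f ≫ scale r d = scale (f ≫ r) (f ≫ d) :=
  hom_ext fun i => by simp [MonObj.comp_mul]

@[simp] theorem scale_zero {S : C} (r : S ⟶ R) : scale r zero = zero :=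
  hom_ext fun i => by simp [zero]

/-- The element `(d, e)` of `D²`. -/
def pair {S : C} (d e : S ⟶ Dpow R 1 ∅) : S ⟶ Dpow R 2 ∅ :=
  mk ![d ≫ coord 0, e ≫ coord 0] (by
    intro i j h
    fin_cases i <;> fin_cases j <;> simp [killed, comp_coord_mul_self] at h ⊢)

/-- The element `(d, e)` of `D(2)`, where `d e = 0`. -/
def pairD2 {S : C} (d e : S ⟶ Dpow R 1 ∅) (h : (d ≫ coord 0) * (e ≫ coord 0) = 0) :
    S ⟶ Dpow R 2 {(0, 1)} :=
  mk ![d ≫ coord 0, e ≫ coord 0] (by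
    intro i j _
    fin_cases i <;> fin_cases j <;> simp [comp_coord_mul_self, h, mul_comm (e ≫ coord 0)])

@[simp] theorem pair_pr_zero {S : C} (d e : S ⟶ Dpow R 1 ∅) : pair d e ≫ pr 0 = d :=
  hom_ext fun i => by fin_cases i; simp [pair, pr]

@[simp] theorem pair_pr_one {S : C} (d e : S ⟶ Dpow R 1 ∅) : pair d e ≫ pr 1 = e :=
  hom_ext fun i => by fin_cases i; simp [pair, pr]

theorem pair_swap {S : C} (d e : S ⟶ Dpow R 1 ∅) : pair d e ≫ swap = pair e d :=
  hom_ext fun i => by fin_cases i <;> simp [pair, swap]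

theorem pairD2_incl {S : C} (d e : S ⟶ Dpow R 1 ∅) (h) : pairD2 d e h ≫ inclD2 = pair d e :=
  hom_ext fun i => by fin_cases i <;> simp [pair, pairD2, inclD2]

end Dpow

/-! ### Infinitesimal transformations X_d as elements of the monoid. -/

namespace VectorField
variable {k : Type w} {R : C} [CommRingObj R] {M A : C}

/-- The map `X_d : M → M` at stage `S`, for elements `a` of `A` and `d` of `D`. -/
def pt (X : VectorField k R M A) {S : C} (a : S ⟶ A) (d : S ⟶ Dpow R 1 ∅) : Endo S M :=
  ⟨X.act (fst S M ≫ a) (fst S M ≫ d) (snd S M)⟩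

theorem pt_mul_hom (X : VectorField k R M A) {S : C} (a : S ⟶ A) (d : S ⟶ Dpow R 1 ∅)
    (f : Endo S M) : (X.pt a d * f).hom = X.act (fst S M ≫ a) (fst S M ≫ d) f.hom := by
  change lift (fst S M) f.hom ≫ X.act _ _ _ = _
  rw [comp_act, lift_fst_assoc, lift_fst_assoc, lift_snd]

/-- Yoneda: the flow is the action on the generic elements, given by the projections (`act_univ`).
-/
theorem ext_act {X Y : VectorField k R M A}
    (h : ∀ {T : C} (a : T ⟶ A) (d : T ⟶ Dpow R 1 ∅) (m : T ⟶ M), X.act a d m = Y.act a d m) :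
    X = Y := by
  apply VectorField.ext
  rw [← act_univ X, ← act_univ Y, h]

theorem pt_ap (X : VectorField k R M A) {T : C} (a : T ⟶ A) (d : T ⟶ Dpow R 1 ∅)
    (m : T ⟶ M) : (X.pt a d).ap m = X.act a d m := by
  simp [Endo.ap, pt, comp_act]

theorem ext_pt {X Y : VectorField k R M A}
    (h : ∀ {S : C} (a : S ⟶ A) (d : S ⟶ Dpow R 1 ∅), X.pt a d = Y.pt a d) : X = Y :=
  ext_act fun a d m => by rw [← pt_ap, ← pt_ap, h]

theorem zero_act {T : C} (a : T ⟶ A) (d : T ⟶ Dpow R 1 ∅) (m : T ⟶ M) :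
    (0 : VectorField k R M A).act a d m = m := by
  change lift (lift a m) d ≫ fst _ _ ≫ snd _ _ = m
  simp

@[simp] theorem zero_pt {S : C} (a : S ⟶ A) (d : S ⟶ Dpow R 1 ∅) :
    (0 : VectorField k R M A).pt a d = 1 :=
  Endo.ext (zero_act _ _ _)

/-- The vector field `d ↦ X_{r d}` at stage `B`, where `r` is an element of `R` at stage `B`. -/
def rescale (X : VectorField k R M A) {B : C} (f : B ⟶ A) (r : B ⟶ R) : VectorField k R M B where
  flow := X.act (fst _ _ ≫ fst _ _ ≫ f) (Dpow.scale (fst _ _ ≫ fst _ _ ≫ r) (snd _ _))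
    (fst _ _ ≫ snd _ _)
  flow_zero := by simp [comp_act, Dpow.comp_scale, act_zero]

theorem rescale_pt (X : VectorField k R M A) {B S : C} (f : B ⟶ A) (r : B ⟶ R) (b : S ⟶ B)
    (d : S ⟶ Dpow R 1 ∅) : (X.rescale f r).pt b d = X.pt (b ≫ f) (Dpow.scale (b ≫ r) d) := by
  apply Endo.ext
  change lift (lift _ _) _ ≫ X.act _ _ _ = X.act _ _ _
  simp [comp_act, Dpow.comp_scale]

instance : Neg (VectorField k R M A) where
  neg X := X.rescale (𝟙 A) (-1)

theorem star_pair (X Y : VectorField k R M A) {T : C} (a : T ⟶ A) (m : T ⟶ M)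
    (d e : T ⟶ Dpow R 1 ∅) :
    lift (lift a m) (Dpow.pair d e) ≫ star Y X = Y.act a e (X.act a d m) := by
  simp [star, comp_act]

theorem axis₁_incl : axis₁ ≫ inclD2 = Dpow.pair (𝟙 (Dpow R 1 ∅)) Dpow.zero :=
  Dpow.hom_ext fun i => by fin_cases i <;> simp [axis₁, inclD2, Dpow.pair, Dpow.zero]

theorem axis₂_incl : axis₂ ≫ inclD2 = Dpow.pair Dpow.zero (𝟙 (Dpow R 1 ∅)) :=
  Dpow.hom_ext fun i => by fin_cases i <;> simp [axis₂, inclD2, Dpow.pair, Dpow.zero]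

theorem diag_incl : diag ≫ inclD2 = Dpow.pair (𝟙 (Dpow R 1 ∅)) (𝟙 (Dpow R 1 ∅)) :=
  Dpow.hom_ext fun i => by fin_cases i <;> simp [diag, inclD2, Dpow.pair]

/-- Two vector fields are glued on `D(2)` by their composite. -/
theorem axes_star (X Y : VectorField k R M A) :
    (A ⊗ M) ◁ axis₁ ≫ (A ⊗ M) ◁ inclD2 ≫ star Y X = X.flow ∧
      (A ⊗ M) ◁ axis₂ ≫ (A ⊗ M) ◁ inclD2 ≫ star Y X = Y.flow := by
  have h1 := axis₁_incl (R := R) =≫ Dpow.pr 0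
  have h2 := axis₁_incl (R := R) =≫ Dpow.pr 1
  have h3 := axis₂_incl (R := R) =≫ Dpow.pr 0
  have h4 := axis₂_incl (R := R) =≫ Dpow.pr 1
  simp only [Category.assoc, Dpow.pair_pr_zero, Dpow.pair_pr_one] at h1 h2 h3 h4
  constructor <;> simp [star, comp_act, act_zero, act_univ, h1, h2, h3, h4]

/-- The map `(d₁, d₂, d₃) ↦ X_{d₁} ∘ Y_{d₂} ∘ Z_{d₃}` on `D³{(1,3),(2,3)}`. -/
def tripleComp (X Y Z : VectorField k R M A) : (A ⊗ M) ⊗ Dpow R 3 {(0, 2), (1, 2)} ⟶ M :=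
  X.act (fst _ _ ≫ fst _ _) (snd _ _ ≫ Dpow.pr 0)
    (Y.act (fst _ _ ≫ fst _ _) (snd _ _ ≫ Dpow.pr 1)
      (Z.act (fst _ _ ≫ fst _ _) (snd _ _ ≫ Dpow.pr 2) (fst _ _ ≫ snd _ _)))

/-- At d₃ = 0 the factor Z disappears. This restriction and the one along `axis₃` are the two that
determine a map on the wedge; the one along `j₁` below then yields the commutator formula. -/
theorem j₂_tripleComp (X Y Z : VectorField k R M A) :
    (A ⊗ M) ◁ j₂ ≫ tripleComp X Y Z = (A ⊗ M) ◁ swap ≫ star X Y := by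
  have h0 : j₂ ≫ Dpow.pr 0 = (Dpow.pr 0 : Dpow R 2 ∅ ⟶ _) :=
    Dpow.hom_ext fun i => by fin_cases i; simp [j₂, Dpow.pr]
  have h1 : j₂ ≫ Dpow.pr 1 = (Dpow.pr 1 : Dpow R 2 ∅ ⟶ _) :=
    Dpow.hom_ext fun i => by fin_cases i; simp [j₂, Dpow.pr]
  have h2 : j₂ ≫ Dpow.pr 2 = (Dpow.zero : Dpow R 2 ∅ ⟶ _) :=
    Dpow.hom_ext fun i => by fin_cases i; simp [j₂, Dpow.pr, Dpow.zero]
  have s0 : swap ≫ Dpow.pr 0 = (Dpow.pr 1 : Dpow R 2 ∅ ⟶ _) :=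
    Dpow.hom_ext fun i => by fin_cases i; simp [swap, Dpow.pr]
  have s1 : swap ≫ Dpow.pr 1 = (Dpow.pr 0 : Dpow R 2 ∅ ⟶ _) :=
    Dpow.hom_ext fun i => by fin_cases i; simp [swap, Dpow.pr]
  simp [tripleComp, star, comp_act, act_zero, h0, h1, h2, s0, s1]

theorem axis₃_tripleComp (X Y Z : VectorField k R M A) :
    (A ⊗ M) ◁ axis₃ ≫ tripleComp X Y Z = Z.flow := by
  have h0 : axis₃ ≫ Dpow.pr 0 = (Dpow.zero : Dpow R 1 ∅ ⟶ _) :=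
    Dpow.hom_ext fun i => by fin_cases i; simp [axis₃, Dpow.pr, Dpow.zero]
  have h1 : axis₃ ≫ Dpow.pr 1 = (Dpow.zero : Dpow R 1 ∅ ⟶ _) :=
    Dpow.hom_ext fun i => by fin_cases i; simp [axis₃, Dpow.pr, Dpow.zero]
  have h2 : axis₃ ≫ Dpow.pr 2 = 𝟙 (Dpow R 1 ∅) :=
    Dpow.hom_ext fun i => by fin_cases i; simp [axis₃, Dpow.pr]
  simp [tripleComp, comp_act, act_zero, act_univ, h0, h1, h2]

theorem j₁_tripleComp (X Y Z : VectorField k R M A) {T : C} (a : T ⟶ A) (m : T ⟶ M)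
    (d e : T ⟶ Dpow R 1 ∅) :
    lift (lift a m) (Dpow.pair d e) ≫ (A ⊗ M) ◁ j₁ ≫ tripleComp X Y Z =
      X.act a d (Y.act a e (Z.act a (Dpow.scale (d ≫ Dpow.coord 0) e) m)) := by
  have h0 : Dpow.pair d e ≫ j₁ ≫ Dpow.pr 0 = d :=
    Dpow.hom_ext fun i => by fin_cases i; simp [j₁, Dpow.pr, Dpow.pair]
  have h1 : Dpow.pair d e ≫ j₁ ≫ Dpow.pr 1 = e :=
    Dpow.hom_ext fun i => by fin_cases i; simp [j₁, Dpow.pr, Dpow.pair]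
  have h2 : Dpow.pair d e ≫ j₁ ≫ Dpow.pr 2 = Dpow.scale (d ≫ Dpow.coord 0) e :=
    Dpow.hom_ext fun i => by fin_cases i; simp [j₁, Dpow.pr, Dpow.pair, MonObj.comp_mul]
  simp [tripleComp, comp_act, h0, h1, h2]

/-! ### Addition as composition, and the additive group of vector fields. -/

variable [CommRing k] [AlgebraObj k R] [KockLawvere k R] [Microlinear k R M]

/-- The pair (d, e) lies in D(2), where the two microsquares entering the bracket agree. -/
theorem act_comm (X Y : VectorField k R M A) {T : C} (a : T ⟶ A) (d e : T ⟶ Dpow R 1 ∅)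
    (m : T ⟶ M) (h : (d ≫ Dpow.coord 0) * (e ≫ Dpow.coord 0) = 0) :
    X.act a d (Y.act a e m) = Y.act a e (X.act a d m) := by
  have := lift (lift a m) (Dpow.pairD2 d e h) ≫= star_compat Y X
  rw [lift_whiskerLeft_assoc, lift_whiskerLeft_assoc, lift_whiskerLeft_assoc, Dpow.pairD2_incl,
    Dpow.pair_swap, star_pair, star_pair] at this
  exact this.symm

theorem pt_comm (X Y : VectorField k R M A) {S : C} (a : S ⟶ A) (d e : S ⟶ Dpow R 1 ∅)
    (h : (d ≫ Dpow.coord 0) * (e ≫ Dpow.coord 0) = 0) : Commute (X.pt a d) (Y.pt a e) := by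
  apply Endo.ext
  rw [pt_mul_hom, pt_mul_hom]
  refine act_comm _ _ _ _ _ _ ?_
  rw [Category.assoc, Category.assoc, ← MonObj.comp_mul, h, AddMonObj.comp_zero]

/-- By uniqueness of the gluing on D(2), the sum may be computed from any explicit map with the
right restrictions to the axes. -/
theorem add_flow (X Y : VectorField k R M A) {l : (A ⊗ M) ⊗ Dpow R 2 {(0, 1)} ⟶ M}
    (h₁ : (A ⊗ M) ◁ axis₁ ≫ l = X.flow) (h₂ : (A ⊗ M) ◁ axis₂ ≫ l = Y.flow) :
    (X + Y).flow = (A ⊗ M) ◁ diag ≫ l := by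
  have h := exists_unique_sum k X.flow Y.flow (X.flow_zero.trans Y.flow_zero.symm)
  exact congrArg ((A ⊗ M) ◁ diag ≫ ·) (h.unique h.choose_spec.1 ⟨h₁, h₂⟩)

/-- The explicit gluing map is (d₁, d₂) ↦ Y_{d₂} ∘ X_{d₁} on D(2), evaluated on the diagonal. -/
theorem add_act (X Y : VectorField k R M A) {T : C} (a : T ⟶ A) (d : T ⟶ Dpow R 1 ∅)
    (m : T ⟶ M) : (X + Y).act a d m = Y.act a d (X.act a d m) := by
  have h1 := diag_incl (R := R) =≫ Dpow.pr 0
  have h2 := diag_incl (R := R) =≫ Dpow.pr 1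
  simp only [Category.assoc, Dpow.pair_pr_zero, Dpow.pair_pr_one] at h1 h2
  rw [act, add_flow X Y (axes_star X Y).1 (axes_star X Y).2]
  simp [star, comp_act, h1, h2]

theorem add_pt_rev (X Y : VectorField k R M A) {S : C} (a : S ⟶ A) (d : S ⟶ Dpow R 1 ∅) :
    (X + Y).pt a d = Y.pt a d * X.pt a d :=
  Endo.ext ((add_act X Y _ _ _).trans (pt_mul_hom ..).symm)

/-- Vector fields are added by composing their infinitesimal transformations. -/
theorem add_pt (X Y : VectorField k R M A) {S : C} (a : S ⟶ A) (d : S ⟶ Dpow R 1 ∅) :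
    (X + Y).pt a d = X.pt a d * Y.pt a d :=
  (add_pt_rev X Y a d).trans (pt_comm Y X a d d (Dpow.comp_coord_mul_self d))

/-- The map `(d₁, d₂) ∈ D(2) ↦ d₁ - d₂ ∈ D`. -/
def subD2 : Dpow R 2 {(0, 1)} ⟶ Dpow R 1 ∅ :=
  Dpow.mk (fun _ => Dpow.coord 0 - Dpow.coord 1) (fun _ _ _ => by
    have h0 := Dpow.coord_self (R := R) (p := {(0, 1)}) (0 : Fin 2)
    have h1 := Dpow.coord_self (R := R) (p := {(0, 1)}) (1 : Fin 2)
    have h2 := Dpow.coord_mul (R := R) (p := {(0, 1)}) (0 : Fin 2) 1 (by decide)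
    linear_combination h0 + h1 - 2 * h2)

theorem add_neg_self (X : VectorField k R M A) : X + -X = 0 := by
  have e1 : axis₁ ≫ subD2 = 𝟙 (Dpow R 1 ∅) :=
    Dpow.hom_ext fun i => by fin_cases i; simp [axis₁, subD2, comp_sub]
  have e2 : axis₂ ≫ subD2 = Dpow.scale (-1) (𝟙 (Dpow R 1 ∅)) :=
    Dpow.hom_ext fun i => by fin_cases i; simp [axis₂, subD2, comp_sub]
  have e3 : diag ≫ subD2 = (Dpow.zero : Dpow R 1 ∅ ⟶ Dpow R 1 ∅) :=
    Dpow.hom_ext fun i => by fin_cases i; simp [diag, subD2, comp_sub, Dpow.zero]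
  apply VectorField.ext
  -- The gluing map is (d₁, d₂) ↦ X_{d₁ - d₂}: it gives X_d and X_{-d} on the axes and X_0 = id on
  -- the diagonal.
  rw [add_flow X (-X) (l := (A ⊗ M) ◁ subD2 ≫ X.flow)]
  · rw [← Category.assoc, ← MonoidalCategory.whiskerLeft_comp, e3]
    have e : (A ⊗ M) ◁ (Dpow.zero : Dpow R 1 ∅ ⟶ Dpow R 1 ∅) =
        fst _ _ ≫ lift (𝟙 (A ⊗ M)) Dpow.zero := by
      ext <;> simp
    rw [e, Category.assoc, X.flow_zero]
    rfl
  · rw [← Category.assoc, ← MonoidalCategory.whiskerLeft_comp, e1]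
    simp
  · rw [← Category.assoc, ← MonoidalCategory.whiskerLeft_comp, e2]
    change _ = X.act _ _ _
    rw [act]
    congr 1
    ext <;> simp [Dpow.comp_scale, comp_neg_one]

/-- The axioms are inherited from the monoid. Commutativity holds because the sum is the composite
in either order. -/
instance : AddCommGroup (VectorField k R M A) where
  add_assoc X Y Z := ext_pt fun a d => by simp only [add_pt, mul_assoc]
  zero_add X := ext_pt fun a d => by simp [add_pt]
  add_zero X := ext_pt fun a d => by simp [add_pt]
  add_comm X Y := ext_pt fun a d => by rw [add_pt, add_pt_rev]
  neg_add_cancel X := ext_pt fun a d => by rw [add_pt_rev, ← add_pt, add_neg_self]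
  nsmul := nsmulRec
  zsmul := zsmulRec

theorem isUnit_pt (X : VectorField k R M A) {S : C} (a : S ⟶ A) (d : S ⟶ Dpow R 1 ∅) :
    IsUnit (X.pt a d) := by
  refine ⟨⟨X.pt a d, (-X).pt a d, ?_, ?_⟩, rfl⟩
  · rw [← add_pt, add_neg_cancel, zero_pt]
  · rw [← add_pt, neg_add_cancel, zero_pt]

/-! ### The bracket as an infinitesimal commutator. -/

theorem act_bracket (X Y : VectorField k R M A) {T : C} (a : T ⟶ A) (d e : T ⟶ Dpow R 1 ∅)
    (m : T ⟶ M) : Y.act a e (X.act a d m) =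
      X.act a d (Y.act a e (⁅X, Y⁆.act a (Dpow.scale (d ≫ Dpow.coord 0) e) m)) := by
  have h := (exists_unique_strongDiff k (star Y X) ((A ⊗ M) ◁ swap ≫ star X Y)
    (star_compat Y X)).choose_spec.1
  -- The chosen map n and X_{d₁} Y_{d₂} [X,Y]_{d₃} agree on both parts of the wedge: on D² by the
  -- second gluing condition, on the third axis by the definition of the bracket.
  have e : _ = tripleComp X Y ⁅X, Y⁆ := hom_ext_wedge k
    (h.2.trans (j₂_tripleComp X Y ⁅X, Y⁆).symm) (axis₃_tripleComp X Y ⁅X, Y⁆).symm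
  rw [e] at h
  rw [← j₁_tripleComp, h.1, star_pair]

/-- The Lie bracket is the commutator of infinitesimal transformations. -/
theorem pt_mul_pt (X Y : VectorField k R M A) {S : C} (a : S ⟶ A) (d e : S ⟶ Dpow R 1 ∅) :
    Y.pt a e * X.pt a d =
      X.pt a d * (Y.pt a e * ⁅X, Y⁆.pt a (Dpow.scale (d ≫ Dpow.coord 0) e)) := by
  apply Endo.ext
  rw [pt_mul_hom, pt_mul_hom, pt_mul_hom]
  refine (act_bracket X Y _ _ _ _).trans ?_
  simp [pt, Dpow.comp_scale]

/-- Converse of `pt_mul_pt`: the commutator formula makes X_{d₁} Y_{d₂} Z_{d₃} a solution of the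
gluing problem that defines the strong difference, so by uniqueness its third axis Z is the bracket.
-/
theorem bracket_eq {X Y Z : VectorField k R M A}
    (h : ∀ {S : C} (a : S ⟶ A) (d e : S ⟶ Dpow R 1 ∅), Y.pt a e * X.pt a d =
      X.pt a d * (Y.pt a e * Z.pt a (Dpow.scale (d ≫ Dpow.coord 0) e))) : ⁅X, Y⁆ = Z := by
  have hu := exists_unique_strongDiff k (star Y X) ((A ⊗ M) ◁ swap ≫ star X Y) (star_compat Y X)
  have hj : (A ⊗ M) ◁ j₁ ≫ tripleComp X Y Z = star Y X := by
    -- The identity is written through the generic point and the generic pair (d₁, d₂), so that the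
    -- hypothesis on elements applies.
    have e : lift (lift (fst (A ⊗ M) (Dpow R 2 ∅) ≫ fst A M) (fst (A ⊗ M) _ ≫ snd A M))
        (Dpow.pair (snd (A ⊗ M) (Dpow R 2 ∅) ≫ Dpow.pr 0) (snd _ _ ≫ Dpow.pr 1)) = 𝟙 _ := by
      ext1
      · ext <;> simp
      · apply Dpow.hom_ext
        intro i
        fin_cases i <;> simp [Dpow.pair, Dpow.pr]
    rw [← Category.id_comp ((A ⊗ M) ◁ j₁ ≫ _), ← e, j₁_tripleComp, ← pt_ap, ← pt_ap, ← pt_ap,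
      ← Endo.mul_ap, ← Endo.mul_ap, mul_assoc, ← h, Endo.mul_ap, pt_ap, pt_ap]
    rfl
  apply VectorField.ext
  refine Eq.trans ?_ (axis₃_tripleComp X Y Z)
  exact congrArg ((A ⊗ M) ◁ axis₃ ≫ ·) (hu.unique hu.choose_spec.1 ⟨hj, j₂_tripleComp X Y Z⟩)

/-! ### Detecting the zero field on products of infinitesimals. -/

/-- A vector field is determined by its values at products of two elements of `D`. -/
theorem eq_zero_of_pt_scale {Z : VectorField k R M A}
    (h : ∀ {S : C} (a : S ⟶ A) (d e : S ⟶ Dpow R 1 ∅),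
      Z.pt a (Dpow.scale (d ≫ Dpow.coord 0) e) = 1) : Z = 0 := by
  -- For X = Y = 0 the commutator formula reduces to Z_{de} = 1, so both Z and 0 equal [0, 0].
  have h1 : ⁅(0 : VectorField k R M A), (0 : VectorField k R M A)⁆ = Z :=
    bracket_eq fun a d e => by simp [h]
  have h2 : ⁅(0 : VectorField k R M A), (0 : VectorField k R M A)⁆ = 0 :=
    bracket_eq fun a d e => by simp
  exact h1.symm.trans h2

/-- A vector field is determined by its values at products of three elements of `D`. -/
theorem eq_zero_of_pt_scale_scale {Z : VectorField k R M A}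
    (h : ∀ {S : C} (a : S ⟶ A) (d e f : S ⟶ Dpow R 1 ∅),
      Z.pt a (Dpow.scale (d ≫ Dpow.coord 0) (Dpow.scale (e ≫ Dpow.coord 0) f)) = 1) : Z = 0 := by
  -- The first factor d is absorbed into the stage: over A × D the field e ↦ Z_{de} is trivial at
  -- products ef, hence zero by the previous lemma.
  have hV : Z.rescale (fst A (Dpow R 1 ∅)) (snd A (Dpow R 1 ∅) ≫ Dpow.coord 0) = 0 :=
    eq_zero_of_pt_scale fun b e f => by
      rw [rescale_pt, ← Category.assoc, h]
  refine eq_zero_of_pt_scale fun a d e => ?_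
  have := congrArg (fun V : VectorField k R M _ => V.pt (lift a d) e) hV
  simpa [rescale_pt] using this

/-! ### Additivity, antisymmetry and the Jacobi identity. -/

theorem bracket_add (X Y Z : VectorField k R M A) : ⁅X, Y + Z⁆ = ⁅X, Y⁆ + ⁅X, Z⁆ := by
  refine bracket_eq fun a d e => ?_
  -- The parameters de and e have product zero, so [X,Y]_{de} can be moved past Z_e.
  have hc : Commute (⁅X, Y⁆.pt a (Dpow.scale (d ≫ Dpow.coord 0) e)) (Z.pt a e) :=
    pt_comm _ _ _ _ _ (by rw [Dpow.scale_coord, mul_assoc, Dpow.comp_coord_mul_self, mul_zero])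
  rw [add_pt, add_pt, mul_assoc, pt_mul_pt X Z, ← mul_assoc, pt_mul_pt X Y]
  simp only [mul_assoc]
  rw [← mul_assoc (⁅X, Y⁆.pt a _) (Z.pt a e), hc.eq]
  simp only [mul_assoc]

theorem bracket_zero (X : VectorField k R M A) : ⁅X, (0 : VectorField k R M A)⁆ = 0 :=
  bracket_eq fun a d e => by simp

/-- Exchanging the two fields inverts the commutator, while the parameter de is symmetric in d and
e. -/
theorem bracket_skew (X Y : VectorField k R M A) : ⁅Y, X⁆ = -⁅X, Y⁆ := by
  refine bracket_eq fun a d e => ?_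
  have he : Dpow.scale (d ≫ Dpow.coord 0) e = Dpow.scale (e ≫ Dpow.coord 0) d :=
    Dpow.hom_ext fun i => by simp [mul_comm]
  rw [← mul_assoc, pt_mul_pt X Y, mul_assoc, mul_assoc, he, ← add_pt, add_neg_cancel, zero_pt,
    mul_one]

/-- A Hall–Witt identity. Here p, q, r are the commutators of x, y, z in pairs, and s, t, u are the
double commutators produced when q passes y, p passes z and r passes x. Reordering zyx to xyz from
either end leaves the same units in front, with s on one side and tu on the other. -/
theorem mul_eq_of_commutators {G : Type*} [Monoid G] {x y z p q r s t u : G}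
    (hx : IsUnit x) (hy : IsUnit y) (hz : IsUnit z) (hp : IsUnit p) (hq : IsUnit q)
    (hr : IsUnit r) (hyx : y * x = x * (y * p)) (hzx : z * x = x * (z * q))
    (hzy : z * y = y * (z * r)) (hrx : r * x = x * (r * u)) (hqy : q * y = y * (q * s))
    (hpz : p * z = z * (p * t)) (hsp : Commute s p) (hpq : Commute p q) (hpr : Commute p r)
    (htq : Commute t q) (htr : Commute t r) (hqr : Commute q r) : s = t * u := by
  have h1 : z * y * x = x * y * z * (r * q * p) * s := by
    calc z * y * x = z * x * (y * p) := by rw [mul_assoc, hyx, mul_assoc]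
      _ = x * z * (q * y) * p := by rw [hzx]; simp only [mul_assoc]
      _ = x * (z * y) * q * (s * p) := by rw [hqy]; simp only [mul_assoc]
      _ = _ := by rw [hzy, hsp.eq]; simp only [mul_assoc]
  have h2 : z * y * x = x * y * z * (r * q * p) * (t * u) := by
    calc z * y * x = y * z * (r * x) := by rw [hzy]; simp only [mul_assoc]
      _ = y * (z * x) * r * u := by rw [hrx]; simp only [mul_assoc]
      _ = y * x * z * q * r * u := by rw [hzx]; simp only [mul_assoc]
      _ = x * y * (p * z) * q * r * u := by rw [hyx]; simp only [mul_assoc]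
      _ = x * y * z * ((p * t) * (q * r)) * u := by rw [hpz]; simp only [mul_assoc]
      _ = x * y * z * ((q * r) * (p * t)) * u := by
        rw [((hpq.mul_right hpr).mul_left (htq.mul_right htr)).eq]
      _ = _ := by rw [hqr.eq]; simp only [mul_assoc]
  exact (((hx.mul hy).mul hz).mul ((hr.mul hq).mul hp)).mul_left_cancel (h1.symm.trans h2)

/-- `mul_eq_of_commutators` is applied to X_d, Y_e, Z_f. All three double brackets then have
parameter def, and their multiplicative relation is the additive one at def. -/
theorem bracket_bracket (X Y Z : VectorField k R M A) :
    ⁅Y, ⁅X, Z⁆⁆ = ⁅Z, ⁅X, Y⁆⁆ + ⁅X, ⁅Y, Z⁆⁆ := by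
  rw [← sub_eq_zero]
  refine eq_zero_of_pt_scale_scale fun a d e f => ?_
  have hd := Dpow.comp_coord_mul_self d
  have he := Dpow.comp_coord_mul_self e
  have hf := Dpow.comp_coord_mul_self f
  have h1 : Dpow.scale (e ≫ Dpow.coord 0) (Dpow.scale (d ≫ Dpow.coord 0) f) =
      Dpow.scale (d ≫ Dpow.coord 0) (Dpow.scale (e ≫ Dpow.coord 0) f) :=
    Dpow.hom_ext fun i => by simp [mul_left_comm]
  have h2 : Dpow.scale (f ≫ Dpow.coord 0) (Dpow.scale (d ≫ Dpow.coord 0) e) =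
      Dpow.scale (d ≫ Dpow.coord 0) (Dpow.scale (e ≫ Dpow.coord 0) f) :=
    Dpow.hom_ext fun i => by simp only [Dpow.scale_coord]; ring
  have key := mul_eq_of_commutators (isUnit_pt X a d) (isUnit_pt Y a e) (isUnit_pt Z a f)
    (isUnit_pt _ a _) (isUnit_pt _ a _) (isUnit_pt _ a _) (pt_mul_pt X Y a d e)
    (pt_mul_pt X Z a d f) (pt_mul_pt Y Z a e f) (pt_mul_pt X ⁅Y, Z⁆ a d _)
    (pt_mul_pt Y ⁅X, Z⁆ a e _) (pt_mul_pt Z ⁅X, Y⁆ a f _)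
    (pt_comm _ _ _ _ _ ?_) (pt_comm _ _ _ _ _ ?_) (pt_comm _ _ _ _ _ ?_) (pt_comm _ _ _ _ _ ?_)
    (pt_comm _ _ _ _ _ ?_) (pt_comm _ _ _ _ _ ?_)
  · rw [h1, h2, ← add_pt] at key
    rw [sub_eq_add_neg, add_pt, key, ← add_pt, add_neg_cancel, zero_pt]
  -- In each pair the two parameters share one of d, e, f, so their product contains a square and
  -- vanishes.
  all_goals simp only [Dpow.scale_coord]; grind

/-- The Jacobi identity. -/
theorem jacobi (X Y Z : VectorField k R M A) :
    ⁅X, ⁅Y, Z⁆⁆ + ⁅Y, ⁅Z, X⁆⁆ + ⁅Z, ⁅X, Y⁆⁆ = 0 := by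
  -- Antisymmetry is applied only to the inner bracket, so additivity in the second argument is
  -- enough.
  have h : ⁅Y, ⁅X, Z⁆⁆ + ⁅Y, ⁅Z, X⁆⁆ = ⁅Y, (0 : VectorField k R M A)⁆ := by
    rw [← bracket_add, bracket_skew X Z, add_neg_cancel]
  rw [bracket_zero, bracket_bracket] at h
  rw [← h]
  abel

theorem bracket_jacobi (W X Y Z : VectorField k R M A) :
    ⁅W, ⁅X, ⁅Y, Z⁆⁆⁆ + ⁅W, ⁅Y, ⁅Z, X⁆⁆⁆ + ⁅W, ⁅Z, ⁅X, Y⁆⁆⁆ = 0 := by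
  rw [← bracket_add, ← bracket_add, jacobi, bracket_zero]

end VectorField

end

end SDG

theorem mainTheorem4 {C : Type u} [Category.{v} C] [CartesianMonoidalCategory C]
    [BraidedCategory C] [HasFiniteLimits C]
    (k : Type w) [CommRing k] (R : C) [CommRingObj R] [SDG.AlgebraObj k R] [SDG.KockLawvere k R]
    (M : C) [SDG.Microlinear k R M]
    (A : C) (X₁ X₂ X₃ X₄ : SDG.VectorField k R M A) :
    ⁅X₁, ⁅X₂, ⁅X₃, X₄⁆⁆⁆ + ⁅X₁, ⁅X₃, ⁅X₄, X₂⁆⁆⁆ + ⁅X₁, ⁅X₄, ⁅X₂, X₃⁆⁆⁆ +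
    ⁅X₂, ⁅X₁, ⁅X₄, X₃⁆⁆⁆ + ⁅X₂, ⁅X₃, ⁅X₁, X₄⁆⁆⁆ + ⁅X₂, ⁅X₄, ⁅X₃, X₁⁆⁆⁆ +
    ⁅X₃, ⁅X₁, ⁅X₂, X₄⁆⁆⁆ + ⁅X₃, ⁅X₂, ⁅X₄, X₁⁆⁆⁆ + ⁅X₃, ⁅X₄, ⁅X₁, X₂⁆⁆⁆ +
    ⁅X₄, ⁅X₁, ⁅X₃, X₂⁆⁆⁆ + ⁅X₄, ⁅X₂, ⁅X₁, X₃⁆⁆⁆ + ⁅X₄, ⁅X₃, ⁅X₂, X₁⁆⁆⁆ = 0 := by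
  -- For each leading index, the order of the other three makes the permutation even; their cyclic
  -- rotations are even too and give the rest of the triple.
  have h₁ := SDG.VectorField.bracket_jacobi X₁ X₂ X₃ X₄
  have h₂ := SDG.VectorField.bracket_jacobi X₂ X₁ X₄ X₃
  have h₃ := SDG.VectorField.bracket_jacobi X₃ X₁ X₂ X₄
  have h₄ := SDG.VectorField.bracket_jacobi X₄ X₁ X₃ X₂
  calc
    _ = (⁅X₁, ⁅X₂, ⁅X₃, X₄⁆⁆⁆ + ⁅X₁, ⁅X₃, ⁅X₄, X₂⁆⁆⁆ + ⁅X₁, ⁅X₄, ⁅X₂, X₃⁆⁆⁆) +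
        (⁅X₂, ⁅X₁, ⁅X₄, X₃⁆⁆⁆ + ⁅X₂, ⁅X₄, ⁅X₃, X₁⁆⁆⁆ + ⁅X₂, ⁅X₃, ⁅X₁, X₄⁆⁆⁆) +
        (⁅X₃, ⁅X₁, ⁅X₂, X₄⁆⁆⁆ + ⁅X₃, ⁅X₂, ⁅X₄, X₁⁆⁆⁆ + ⁅X₃, ⁅X₄, ⁅X₁, X₂⁆⁆⁆) +
        (⁅X₄, ⁅X₁, ⁅X₃, X₂⁆⁆⁆ + ⁅X₄, ⁅X₃, ⁅X₂, X₁⁆⁆⁆ + ⁅X₄, ⁅X₂, ⁅X₁, X₃⁆⁆⁆) := by abel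
    _ = 0 := by rw [h₁, h₂, h₃, h₄]; simp
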